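/- Let $N,M\ge 1$ be integers and let $P,P_r,N_0,P_{I1},\dots,P_{IM}>0$. Put $\rho_1=P/N_0$, $\rho_2=P_r/N_0$, $\rho_{Ii}=P_{Ii}/N_0$ and $D=\mathrm{diag}(\rho_{I1},\dots,\rho_{IM})$. Let $h_1,h_2,h_{I1},\dots,h_{IM}$ be random vectors in $\mathbb C^N$ all of whose entries are independent $\mathcal{CN}(0,1)$ variables (source–relay, relay–destination and interferer–relay channels). A relay matrix $W$ gives the end-to-end SINR $$\gamma=\frac{|h_2^\dagger W h_1|^2P}{\sum_{i=1}^M|h_2^\dagger W h_{Ii}|^2P_{Ii}+\|h_2^\dagger W\|^2N_0+N_0}.$$ For the MRC/MRT scheme $W=\omega\,\frac{h_2}{\|h_2\|}\frac{h_1^\dagger}{\|h_1\|}$ with $\omega^2=\rho_2/(\|h_1\|^2\rho_1+U_1+1)$, $U_1=\sum_{i=1}^M\frac{|h_1^\dagger h_{Ii}|^2}{\|h_1\|^2}\rho_{Ii}$; let $\gamma_{\rm MRC}$ be the resulting SINR and $C_{\rm MRC}=\frac12\mathrm E[\log_2(1+\gamma_{\rm MRC})]$ the ergodic capacity. Put $\gamma_1=\frac{\|h_1\|^2\rho_1}{U_1+1}$,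 $\gamma_2=\|h_2\|^2\rho_2$, and $C_{\gamma_i}=\frac12\mathrm E[\log_2(1+\gamma_i)]$. Let $\rho_{I\langle 1\rangle}>\dots>\rho_{I\langle\rho(D)\rangle}$ be the distinct diagonal elements of $D$, with multiplicities $\tau_i(D)$, and let $\chi_{i,j}(D)$ be the characteristic coefficients of $D$, i.e. the coefficients in $\det(I+\xi D)^{-1}=\sum_{i=1}^{\rho(D)}\sum_{j=1}^{\tau_i(D)}\chi_{i,j}(D)(1+\xi\rho_{I\langle i\rangle})^{-j}$ for $\xi\ge 0$. Let $\Gamma(\alpha,x)=\int_x^\infty e^{-t}t^{\alpha-1}dt$ be the upper incomplete gamma function and $\Psi(a,b;z)$ the Tricomi confluent hypergeometric function, $\Psi(a,b;z)=\frac1{\Gamma(a)}\int_0^\infty e^{-zt}t^{a-1}(1+t)^{b-a-1}dt$ for $a,z>0$. Let $$\mathrm G\!\left({x\atop y}\middle|\,a;\,b,c;\,-;\,d,e\right)=\frac1{(2\pi i)^2}\iint\Gamma(a+s+t)\,\Gamma(d-s)\Gamma(1-b+s)\,\Gamma(e-t)\Gamma(1-c+t)\,x^sy^t\,ds\,dt$$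 be the generalized Meijer function $\mathrm G^{1,1,1,1,1}_{1,[1:1],0,[1:1]}$ of two variables, integrated along vertical lines that separate the poles of $\Gamma(a+s+t)$, $\Gamma(1-b+s)$, $\Gamma(1-c+t)$ from those of $\Gamma(d-s)$, $\Gamma(e-t)$. Then all the expectations involved are finite, $$C_{\gamma_1}=\frac{\rho_1}{2\ln2}\sum_{k=0}^{N-1}\frac1{k!}\sum_{l=0}^k\binom kl\sum_{i=1}^{\rho(D)}\sum_{j=1}^{\tau_i(D)}\chi_{i,j}(D)\frac{\rho_{I\langle i\rangle}^l}{\Gamma(j)}\,\mathrm G\!\left({\rho_1\atop\rho_{I\langle i\rangle}}\middle|\,k+1;\,0,1-j-l;\,-;\,0,0\right),$$ $$C_{\gamma_2}=\frac{e^{1/\rho_2}}{2\ln2}\sum_{k=0}^{N-1}\frac1{\rho_2^k}\Gamma\!\left(-k,\frac1{\rho_2}\right),\qquad \mathrm E(\gamma_2)=N\rho_2,\qquad \mathrm E(\gamma_1)=\mathcal A_2,$$ $$\mathcal A_2=\rho_1\sum_{k=0}^{N-1}\sum_{l=0}^k\binom kl\sum_{i=1}^{\rho(D)}\sum_{j=1}^{\tau_i(D)}\chi_{i,j}(D)\frac{\Gamma(j+l)}{\Gamma(j)}\rho_{I\langle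 i\rangle}^{l-k-1}\Psi\!\left(k+1,k-j-l+2;\frac1{\rho_{I\langle i\rangle}}\right),$$ and the ergodic capacity of the MRC/MRT scheme satisfies, with $C_{\gamma_1},C_{\gamma_2}$ given by the above closed forms, $$C_{\rm MRC}\;\ge\;C_{\rm MRC}^{\rm low}=C_{\gamma_1}+C_{\gamma_2}-\frac12\log_2\left(1+N\rho_2+\mathcal A_2\right).$$ -/

import Mathlib

open MeasureTheory ProbabilityTheory

noncomputable section

namespace RelayMRC

/-! ### Special functions -/

/-- The upper incomplete gamma function `Γ(α, x) = ∫_x^∞ e^{-t} t^{α-1} dt`, for `x > 0`. -/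
def upperGamma (α x : ℝ) : ℝ :=
  ∫ t in Set.Ioi x, Real.exp (-t) * t ^ (α - 1)

/-- The Tricomi confluent hypergeometric function `Ψ(a, b; z)`, for `a > 0`, `z > 0` and every
real `b` (integers included), as the integral
`Γ(a)⁻¹ ∫_0^∞ e^{-zt} t^{a-1} (1+t)^{b-a-1} dt`. -/
def tricomiPsi (a b z : ℝ) : ℝ :=
  (Real.Gamma a)⁻¹ *
    ∫ t in Set.Ioi (0 : ℝ), Real.exp (-(z * t)) * t ^ (a - 1) * (1 + t) ^ (b - a - 1)

/-- The Mellin-Barnes integrand of the two-variable Meijer function `meijerG2`. -/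
def meijerKernel (a b c d e x y : ℝ) (s t : ℂ) : ℂ :=
  Complex.Gamma (a + s + t)
    * (Complex.Gamma (d - s) * Complex.Gamma (1 - b + s))
    * (Complex.Gamma (e - t) * Complex.Gamma (1 - c + t))
    * (x : ℂ) ^ s * (y : ℂ) ^ t

/-- The lines `Re s = σ`, `Re t = τ` separate the poles of `Γ(1-b+s)`, `Γ(1-c+t)` and
`Γ(a+s+t)` (on the left) from those of `Γ(d-s)` and `Γ(e-t)` (on the right). -/
def IsSeparating (a b c d e : ℝ) (p : ℝ × ℝ) : Prop :=
  b - 1 < p.1 ∧ p.1 < d ∧ c - 1 < p.2 ∧ p.2 < e ∧ -a < p.1 + p.2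

/-- `(2πi)⁻² ∫∫ meijerKernel(s, t) ds dt` along the lines `Re s = p.1`, `Re t = p.2`. -/
def meijerLine (a b c d e x y : ℝ) (p : ℝ × ℝ) : ℂ :=
  (1 / (2 * (Real.pi : ℂ)) ^ 2) * ∫ u : ℝ × ℝ,
    meijerKernel a b c d e x y (p.1 + u.1 * Complex.I) (p.2 + u.2 * Complex.I)

/-- For real parameters and positive arguments the Mellin-Barnes integral is a real number. -/
theorem meijerLine_im (a b c d e x y : ℝ) (hx : 0 < x) (hy : 0 < y) (p : ℝ × ℝ) :
    (meijerLine a b c d e x y p).im = 0 := by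
  rw [← Complex.conj_eq_iff_im]
  have hk : ∀ s t : ℂ, (starRingEnd ℂ) (meijerKernel a b c d e x y s t)
      = meijerKernel a b c d e x y ((starRingEnd ℂ) s) ((starRingEnd ℂ) t) := by
    intro s t
    have hpow : ∀ (r : ℝ) (_ : 0 < r) (w : ℂ),
        (starRingEnd ℂ) ((r : ℂ) ^ w) = (r : ℂ) ^ ((starRingEnd ℂ) w) := by
      intro r hr w
      have h := Complex.cpow_conj (r : ℂ) w (by
        rw [Complex.arg_ofReal_of_nonneg hr.le]; exact Real.pi_pos.ne)
      rw [h, Complex.conj_ofReal]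
    simp only [meijerKernel, map_mul, ← Complex.Gamma_conj, map_add, map_sub, map_one,
      Complex.conj_ofReal, hpow x hx, hpow y hy]
  unfold meijerLine
  rw [map_mul, ← integral_conj]
  congr 1
  · simp only [map_div₀, map_one, map_pow, map_mul, Complex.conj_ofReal, Complex.conj_ofNat]
  · rw [← integral_neg_eq_self]
    refine integral_congr_ae (Filter.Eventually.of_forall fun u => ?_)
    simp only [hk]
    congr 1 <;> simp

/-- The generalized Meijer `G` function of two variables
`G^{1,1,1,1,1}_{1,[1:1],0,[1:1]}(x, y | a; b; c; -; d; e)`, that is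
`(2πi)⁻² ∫∫ Γ(a+s+t) Γ(d-s) Γ(1-b+s) Γ(e-t) Γ(1-c+t) x^s y^t ds dt` along vertical lines
that separate the poles (the value does not depend on which such lines are taken). -/
def meijerG2 (a b c d e x y : ℝ) : ℝ :=
  (meijerLine a b c d e x y (Classical.epsilon (IsSeparating a b c d e))).re

/-! ### Characteristic coefficients of `D = diag(ρ)` -/

/-- The distinct diagonal elements of `D = diag(ρ)`. -/
def distinctValues {M : ℕ} (ρ : Fin M → ℝ) : Finset ℝ := Finset.univ.image ρ

/-- The multiplicity of `a` as a diagonal element of `D = diag(ρ)`. -/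
def multiplicity {M : ℕ} (ρ : Fin M → ℝ) (a : ℝ) : ℕ :=
  (Finset.univ.filter fun m => ρ m = a).card

/-- `χ a j` are the coefficients of the partial fraction expansion
`det(I + ξ D)⁻¹ = ∑_a ∑_{j = 1}^{mult a} χ a j (1 + ξ a)^{-j}`, `D = diag(ρ)`.
The distinct diagonal elements themselves, rather than their ranks, serve as indices. -/
def IsCharCoeff {M : ℕ} (ρ : Fin M → ℝ) (χ : ℝ → ℕ → ℝ) : Prop :=
  ∀ ξ : ℝ, 0 ≤ ξ → (Matrix.det (1 + ξ • Matrix.diagonal ρ))⁻¹ =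
    ∑ a ∈ distinctValues ρ, ∑ j ∈ Finset.Icc 1 (multiplicity ρ a), χ a j / (1 + ξ * a) ^ j

/-- The characteristic coefficients of `D = diag(ρ)`. -/
def charCoeff {M : ℕ} (ρ : Fin M → ℝ) : ℝ → ℕ → ℝ :=
  Classical.epsilon (IsCharCoeff ρ)

/-- Multiplying one partial fraction by another one with a different pole. -/
theorem pf_mul_mem (V : Submodule ℝ (Set.Ici (0 : ℝ) → ℝ)) (a b : ℝ) (ha : 0 < a) (hb : 0 < b)
    (hab : b ≠ a) (n : ℕ) (hVb : (fun ξ : Set.Ici (0 : ℝ) => 1 / (1 + (ξ : ℝ) * b)) ∈ V)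
    (hVa : ∀ j, 1 ≤ j → j ≤ n → (fun ξ : Set.Ici (0 : ℝ) => 1 / (1 + (ξ : ℝ) * a) ^ j) ∈ V) :
    (fun ξ : Set.Ici (0 : ℝ) => 1 / (1 + (ξ : ℝ) * b) * (1 / (1 + (ξ : ℝ) * a) ^ n)) ∈ V := by
  induction n with
  | zero => simpa using hVb
  | succ n ih =>
    have h1 := ih fun j h h' => hVa j h (by omega)
    have h2 := hVa (n + 1) (by omega) le_rfl
    have h3 := V.sub_mem (V.smul_mem (b / (b - a)) h1) (V.smul_mem (a / (b - a)) h2)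
    convert h3 using 1
    funext ξ
    have hξ : (0 : ℝ) ≤ ξ := ξ.2
    have e1 : (1 + (ξ : ℝ) * b) ≠ 0 := by positivity
    have e2 : (1 + (ξ : ℝ) * a) ≠ 0 := by positivity
    have e3 : b - a ≠ 0 := sub_ne_zero.mpr hab
    simp only [Pi.sub_apply, Pi.smul_apply, smul_eq_mul]
    field_simp
    ring

/-- The expansion that defines the characteristic coefficients exists. -/
theorem isCharCoeff_charCoeff {M : ℕ} (hM : 0 < M) (ρ : Fin M → ℝ) (hρ : ∀ m, 0 < ρ m) :
    IsCharCoeff ρ (charCoeff ρ) := by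
  classical
  apply Classical.epsilon_spec (p := IsCharCoeff ρ)
  let g : ℝ × ℕ → Set.Ici (0 : ℝ) → ℝ := fun q ξ => 1 / (1 + (ξ : ℝ) * q.1) ^ q.2
  let J : Finset (Fin M) → Set (ℝ × ℕ) := fun s =>
    {q | q.1 ∈ s.image ρ ∧ 1 ≤ q.2 ∧ q.2 ≤ (s.filter fun m => ρ m = q.1).card}
  have key : ∀ s : Finset (Fin M), s.Nonempty →
      (fun ξ : Set.Ici (0 : ℝ) => ∏ m ∈ s, 1 / (1 + (ξ : ℝ) * ρ m))
        ∈ Submodule.span ℝ (g '' J s) := by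
    intro s hs
    induction hs using Finset.Nonempty.cons_induction with
    | singleton m =>
      refine Submodule.subset_span ⟨(ρ m, 1), ⟨by simp, le_rfl, ?_⟩, ?_⟩
      · simp [Finset.filter_singleton]
      · funext ξ; simp [g]
    | cons m s hm hs ih =>
      have hmono : ∀ q ∈ J s, q ∈ J (Finset.cons m s hm) := by
        rintro q ⟨h1, h2, h3⟩
        refine ⟨?_, h2, h3.trans (Finset.card_le_card ?_)⟩
        · rw [Finset.mem_image] at h1 ⊢
          obtain ⟨k, hk, hk'⟩ := h1
          exact ⟨k, by simp [hk], hk'⟩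
        · exact Finset.filter_subset_filter _ (Finset.subset_cons hm)
      let L : (Set.Ici (0 : ℝ) → ℝ) →ₗ[ℝ] (Set.Ici (0 : ℝ) → ℝ) :=
        LinearMap.mulLeft ℝ (fun ξ : Set.Ici (0 : ℝ) => 1 / (1 + (ξ : ℝ) * ρ m))
      have hL : Submodule.span ℝ (g '' J s) ≤
          (Submodule.span ℝ (g '' J (Finset.cons m s hm))).comap L := by
        rw [Submodule.span_le]
        rintro _ ⟨q, hq, rfl⟩
        obtain ⟨a, j⟩ := q
        by_cases ham : ρ m = a
        · refine Submodule.subset_span ⟨(a, j + 1), ⟨?_, by simp, ?_⟩, ?_⟩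
          · rw [Finset.mem_image]; exact ⟨m, by simp, ham⟩
          · have h3 := hq.2.2
            simp only at h3 ⊢
            rw [Finset.filter_cons_of_pos (ha := hm) (hp := ham), Finset.card_cons]
            omega
          · funext ξ
            simp only [g, L, LinearMap.mulLeft_apply, Pi.mul_apply, ham]
            rw [one_div_mul_one_div, pow_succ']
        · have hapos : 0 < a := by
            obtain ⟨k, -, hk⟩ := Finset.mem_image.mp hq.1
            simp only at hk
            exact hk ▸ hρ k
          change (fun ξ : Set.Ici (0 : ℝ) => 1 / (1 + (ξ : ℝ) * ρ m) * (1 / (1 + (ξ : ℝ) * a) ^ j))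
            ∈ Submodule.span ℝ (g '' J (Finset.cons m s hm))
          refine pf_mul_mem _ a (ρ m) hapos (hρ m) ham j ?_ ?_
          · refine Submodule.subset_span ⟨(ρ m, 1), ⟨?_, le_rfl, ?_⟩, ?_⟩
            · rw [Finset.mem_image]; exact ⟨m, by simp, rfl⟩
            · exact Finset.card_pos.mpr ⟨m, by simp⟩
            · funext ξ; simp [g]
          · intro i hi hij
            exact Submodule.subset_span
              ⟨(a, i), hmono _ ⟨hq.1, hi, hij.trans hq.2.2⟩, rfl⟩
      have := hL ih
      rw [Submodule.mem_comap] at this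
      convert this using 1
      funext ξ
      rw [Finset.prod_cons]
      rfl
  have hne : (Finset.univ : Finset (Fin M)).Nonempty := ⟨⟨0, hM⟩, Finset.mem_univ _⟩
  have hfin : J Finset.univ = ((distinctValues ρ).sigma fun a =>
      Finset.Icc 1 (multiplicity ρ a)).image fun q => (q.1, q.2) := by
    ext ⟨a, j⟩
    simp [J, distinctValues, multiplicity]
  have h := key _ hne
  rw [hfin, Submodule.mem_span_image_finset_iff_exists_fun'] at h
  obtain ⟨c, hc⟩ := h
  refine ⟨fun a j => c (a, j), fun ξ hξ => ?_⟩
  have h := congrFun hc ⟨ξ, hξ⟩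
  have hdet : (Matrix.det (1 + ξ • Matrix.diagonal ρ))⁻¹ = ∏ m, 1 / (1 + ξ * ρ m) := by
    have : (1 + ξ • Matrix.diagonal ρ) = Matrix.diagonal fun m => 1 + ξ * ρ m := by
      rw [← Matrix.diagonal_one, ← Matrix.diagonal_smul, Matrix.diagonal_add]
      rfl
    rw [this, Matrix.det_diagonal, ← Finset.prod_inv_distrib]
    simp
  rw [hdet, ← h, Finset.sum_apply, Finset.sum_image, Finset.sum_sigma]
  · simp [g, div_eq_mul_inv]
  · rintro ⟨a, j⟩ - ⟨a', j'⟩ - hq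
    simpa using hq

/-- The sum over the distinct diagonal elements `a` of `D` and over `1 ≤ j ≤ mult a` of
`χ a j * f a j`, with `χ` the characteristic coefficients of `D`. -/
def charSum {M : ℕ} (ρ : Fin M → ℝ) (f : ℝ → ℕ → ℝ) : ℝ :=
  ∑ a ∈ distinctValues ρ, ∑ j ∈ Finset.Icc 1 (multiplicity ρ a), charCoeff ρ a j * f a j

/-! ### The channel -/

/-- The law `CN(0,1)`: real and imaginary parts are independent `N(0, 1/2)`. -/
def complexGaussian : Measure ℂ :=
  ((gaussianReal 0 (1 / 2)).prod (gaussianReal 0 (1 / 2))).map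
    Complex.measurableEquivRealProd.symm

/-- All entries of the source-relay channel `h₁`, of the relay-destination channel `h₂` and of
the `M` interferer-relay channels `hI i` are independent `CN(0,1)` random variables. -/
structure IsRayleighChannel {Ω : Type*} [MeasurableSpace Ω] (μ : Measure Ω) {N M : ℕ}
    (h₁ h₂ : Ω → Fin N → ℂ) (hI : Fin M → Ω → Fin N → ℂ) : Prop where
  law₁ : ∀ n, HasLaw (fun ω => h₁ ω n) complexGaussian μ
  law₂ : ∀ n, HasLaw (fun ω => h₂ ω n) complexGaussian μ
  lawI : ∀ i n, HasLaw (fun ω => hI i ω n) complexGaussian μ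
  indep : iIndepFun (fun (k : Fin N ⊕ Fin N ⊕ (Fin M × Fin N)) (ω : Ω) =>
    Sum.elim (h₁ ω) (Sum.elim (h₂ ω) fun q => hI q.1 ω q.2) k) μ

/-- The squared Frobenius norm of a vector. -/
def sqNorm {N : ℕ} (v : Fin N → ℂ) : ℝ := ∑ n, ‖v n‖ ^ 2

/-- The Frobenius norm of a vector. -/
def frobNorm {N : ℕ} (v : Fin N → ℂ) : ℝ := Real.sqrt (sqNorm v)

/-- `u† v`. -/
def cdot {N : ℕ} (u v : Fin N → ℂ) : ℂ := dotProduct (star u) v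

/-- The end-to-end SINR
`|h₂† W h₁|² P / (∑ i, |h₂† W hI i|² PI i + ‖h₂† W‖² N₀ + N₀)` for a relay matrix `W`. -/
def endToEndSINR {N M : ℕ} (P N₀ : ℝ) (PI : Fin M → ℝ) (h₁ h₂ : Fin N → ℂ)
    (hI : Fin M → Fin N → ℂ) (W : Matrix (Fin N) (Fin N) ℂ) : ℝ :=
  ‖cdot h₂ (W.mulVec h₁)‖ ^ 2 * P /
    (∑ i, ‖cdot h₂ (W.mulVec (hI i))‖ ^ 2 * PI i
      + sqNorm (Matrix.vecMul (star h₂) W) * N₀ + N₀)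

/-- `U₁ = ∑ i, |h₁† hI i|² / ‖h₁‖² ρI i`. -/
def interference {N M : ℕ} (ρI : Fin M → ℝ) (h₁ : Fin N → ℂ) (hI : Fin M → Fin N → ℂ) : ℝ :=
  ∑ i, ‖cdot h₁ (hI i)‖ ^ 2 / sqNorm h₁ * ρI i

/-- The power constraint factor: `ω² = ρ₂ / (‖h₁‖² ρ₁ + U₁ + 1)`. -/
def mrcOmega {N M : ℕ} (ρ₁ ρ₂ : ℝ) (ρI : Fin M → ℝ) (h₁ : Fin N → ℂ)
    (hI : Fin M → Fin N → ℂ) : ℝ :=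
  Real.sqrt (ρ₂ / (sqNorm h₁ * ρ₁ + interference ρI h₁ hI + 1))

/-- The MRC/MRT relay matrix `W = ω (h₂ / ‖h₂‖) (h₁† / ‖h₁‖)`. -/
def mrcMatrix {N M : ℕ} (ρ₁ ρ₂ : ℝ) (ρI : Fin M → ℝ) (h₁ h₂ : Fin N → ℂ)
    (hI : Fin M → Fin N → ℂ) : Matrix (Fin N) (Fin N) ℂ :=
  (mrcOmega ρ₁ ρ₂ ρI h₁ hI : ℂ) •
    Matrix.vecMulVec (fun n => h₂ n / (frobNorm h₂ : ℂ)) (fun n => star (h₁ n) / (frobNorm h₁ : ℂ))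

/-- The end-to-end SINR of the MRC/MRT scheme with source power `P`, relay power `Pr`,
interferer powers `PI i` and noise power `N₀`. -/
def gammaMRC {N M : ℕ} (P Pr N₀ : ℝ) (PI : Fin M → ℝ) (h₁ h₂ : Fin N → ℂ)
    (hI : Fin M → Fin N → ℂ) : ℝ :=
  endToEndSINR P N₀ PI h₁ h₂ hI
    (mrcMatrix (P / N₀) (Pr / N₀) (fun i => PI i / N₀) h₁ h₂ hI)

/-- The first-hop SINR `γ₁ = ‖h₁‖² ρ₁ / (U₁ + 1)`. -/
def gamma1 {N M : ℕ} (ρ₁ : ℝ) (ρI : Fin M → ℝ) (h₁ : Fin N → ℂ) (hI : Fin M → Fin N → ℂ) : ℝ :=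
  sqNorm h₁ * ρ₁ / (interference ρI h₁ hI + 1)

/-- The second-hop SNR `γ₂ = ‖h₂‖² ρ₂`. -/
def gamma2 {N : ℕ} (ρ₂ : ℝ) (h₂ : Fin N → ℂ) : ℝ := sqNorm h₂ * ρ₂

/-- The ergodic capacity `½ E[log₂(1 + γ)]`. -/
def ergodicCapacity {Ω : Type*} [MeasurableSpace Ω] (μ : Measure Ω) (γ : Ω → ℝ) : ℝ :=
  1 / 2 * ∫ ω, Real.logb 2 (1 + γ ω) ∂μ

/-! ### The closed-form expressions -/

/-- The closed form of `C_{γ₁}`. -/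
def capacityTerm1 (N : ℕ) {M : ℕ} (ρ₁ : ℝ) (ρI : Fin M → ℝ) : ℝ :=
  ρ₁ / (2 * Real.log 2) * ∑ k ∈ Finset.range N, 1 / (k.factorial : ℝ) *
    ∑ l ∈ Finset.range (k + 1), (k.choose l : ℝ) *
      charSum ρI fun a j => a ^ l / Real.Gamma j *
        meijerG2 ((k : ℝ) + 1) 0 (1 - (j : ℝ) - (l : ℝ)) 0 0 ρ₁ a

/-- The closed form of `C_{γ₂}`. -/
def capacityTerm2 (N : ℕ) (ρ₂ : ℝ) : ℝ :=
  Real.exp (1 / ρ₂) / (2 * Real.log 2) *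
    ∑ k ∈ Finset.range N, 1 / ρ₂ ^ k * upperGamma (-(k : ℝ)) (1 / ρ₂)

/-- The closed form of `E(γ₁)`. -/
def meanTerm1 (N : ℕ) {M : ℕ} (ρ₁ : ℝ) (ρI : Fin M → ℝ) : ℝ :=
  ρ₁ * ∑ k ∈ Finset.range N, ∑ l ∈ Finset.range (k + 1), (k.choose l : ℝ) *
    charSum ρI fun a j => Real.Gamma ((j : ℝ) + (l : ℝ)) / Real.Gamma j *
      a ^ ((l : ℤ) - (k : ℤ) - 1) *
        tricomiPsi ((k : ℝ) + 1) ((k : ℝ) - (j : ℝ) - (l : ℝ) + 2) (1 / a)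

/-- The closed-form lower bound on the ergodic capacity of the MRC/MRT scheme. -/
def capacityLow (N : ℕ) {M : ℕ} (ρ₁ ρ₂ : ℝ) (ρI : Fin M → ℝ) : ℝ :=
  capacityTerm1 N ρ₁ ρI + capacityTerm2 N ρ₂
    - 1 / 2 * Real.logb 2 (1 + N * ρ₂ + meanTerm1 N ρ₁ ρI)

end RelayMRC

end

noncomputable section

namespace RelayMRC

/-! The relay matrix has rank one, so the end-to-end SINR collapses to `γ₁γ₂ / (γ₁ + γ₂ + 1)`
(`gammaMRC_eq`), and `1 + γ = (1 + γ₁)(1 + γ₂) / (1 + γ₁ + γ₂)`. The logarithm splits into three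
terms. Jensen's inequality for the subtracted one, `E log (1 + γ₁ + γ₂)`, gives the lower bound once
the expectations of `γᵢ` and `log (1 + γᵢ)` are known exactly.

Those expectations are Laplace-type integrals. Given `h₁ ≠ 0`, each interferer enters `U₁` through
its projection on a unit vector, which is again `CN(0,1)`; the Laplace transform of `U₁` is
therefore `det(I + tD)⁻¹` whatever `h₁` is, and `U₁` decouples from `‖h₁‖²`
(`integral_mul_exp_neg_interference`). The Frullani formula `log (1 + b/A) = ∫ e^{-As} (1 - e^{-bs})
/ s ds` (`integral_log_kernel`) turns `E log (1 + γ₁)` into `∫ e^{-y} (1 - (1 + ρ₁y)^{-N}) / y ·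
det(I + yD)⁻¹ dy`. The means come from `1/A = ∫ e^{-As} ds`, and the second hop is the case `U₁ =
0`.

The closed forms reduce to the same integrals. Mellin inversion of `(1 + x)⁻ⁿ` evaluates the Meijer
function as a real integral (`meijerG2_eq`). The binomial sum over `l` then collapses by averaging
one elementary identity over a gamma law (`integral_laplace_shift`), the characteristic coefficients
reassemble the determinant (`charSum_integral`), and the sum over `k` is geometric
(`sum_div_one_add_pow`). -/

/-- Tonelli's theorem for Bochner integrals of nonnegative functions with integrable sections. -/
theorem integral_integral_swap_of_nonneg {α β : Type*} [MeasurableSpace α] [MeasurableSpace β]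
    {μ : Measure α} {ν : Measure β} [SFinite μ] [SFinite ν] {f : α → β → ℝ}
    (hm : AEStronglyMeasurable (Function.uncurry f) (μ.prod ν))
    (h₀ : ∀ᵐ x ∂μ, ∀ᵐ y ∂ν, 0 ≤ f x y) (h₀' : ∀ᵐ y ∂ν, ∀ᵐ x ∂μ, 0 ≤ f x y)
    (h₁ : ∀ᵐ x ∂μ, Integrable (f x) ν) (h₂ : ∀ᵐ y ∂ν, Integrable (fun x => f x y) μ) :
    ∫ x, ∫ y, f x y ∂ν ∂μ = ∫ y, ∫ x, f x y ∂μ ∂ν := by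
  by_cases h : Integrable (Function.uncurry f) (μ.prod ν)
  · exact integral_integral_swap h
  · have e₁ : (fun x => ∫ y, ‖f x y‖ ∂ν) =ᵐ[μ] fun x => ∫ y, f x y ∂ν := by
      filter_upwards [h₀] with x hx
      refine integral_congr_ae ?_
      filter_upwards [hx] with y hy
      exact Real.norm_of_nonneg hy
    have e₂ : (fun y => ∫ x, ‖f x y‖ ∂μ) =ᵐ[ν] fun y => ∫ x, f x y ∂μ := by
      filter_upwards [h₀'] with y hy
      refine integral_congr_ae ?_
      filter_upwards [hy] with x hx
      exact Real.norm_of_nonneg hx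
    -- With nonnegative, integrable sections, integrability of either outer integral would force
    -- joint integrability. Without it both iterated integrals take the default value `0`, so they
    -- still agree.
    rw [integral_undef, integral_undef]
    · intro h'
      exact h ((integrable_prod_iff' hm).2 ⟨h₂, h'.congr e₂.symm⟩)
    · intro h'
      exact h ((integrable_prod_iff hm).2 ⟨h₁, h'.congr e₁.symm⟩)

/-! ### Mellin–Barnes integrals and the two-variable Meijer function -/

theorem norm_Gamma_le {s : ℂ} (hs : 0 < s.re) : ‖Complex.Gamma s‖ ≤ Real.Gamma s.re := by
  rw [Complex.Gamma_eq_integral hs, Complex.GammaIntegral, Real.Gamma_eq_integral hs]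
  refine (norm_integral_le_integral_norm _).trans_eq ?_
  refine setIntegral_congr_fun measurableSet_Ioi fun x hx => ?_
  simp only [norm_mul, Complex.norm_cpow_eq_rpow_re_of_pos hx, Complex.norm_real,
    Real.norm_of_nonneg (Real.exp_pos _).le, Complex.sub_re, Complex.one_re]

theorem continuous_Gamma_line {σ : ℝ} (hσ : 0 < σ) (ε : ℝ) :
    Continuous fun u : ℝ => Complex.Gamma (σ + ε * u * Complex.I) := by
  rw [continuous_iff_continuousAt]
  intro u
  refine ContinuousAt.comp (f := fun u : ℝ => (σ + ε * u * Complex.I : ℂ))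
    (g := Complex.Gamma) ?_ (by fun_prop)
  refine (Complex.differentiableAt_Gamma _ fun m h => ?_).continuousAt
  have := congrArg Complex.re h
  simp at this
  have : (0 : ℝ) ≤ m := m.cast_nonneg
  linarith

/-- Crude decay suffices: `Γ(s) = Γ(s + 2) / (s(s + 1))` with `Γ(s + 2)` bounded on the vertical
line gives order `|s|⁻²`, and the other Gamma factor is bounded by its value on the real axis. -/
theorem integrable_Gamma_mul_Gamma {σ n : ℝ} (h₀ : 0 < σ) (hn : σ < n) :
    Integrable fun u : ℝ =>
      Complex.Gamma (σ + u * Complex.I) * Complex.Gamma (n - (σ + u * Complex.I)) := by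
  have hbound : Integrable fun u : ℝ =>
      (Real.Gamma (σ + 2) * Real.Gamma (n - σ) * (σ ^ 2)⁻¹) * (1 + (u / σ) ^ 2)⁻¹ :=
    (integrable_inv_one_add_sq.comp_div h₀.ne').const_mul _
  refine hbound.mono' ?_ (Filter.Eventually.of_forall fun u => ?_)
  · have h1 := continuous_Gamma_line h₀ 1
    have h2 := continuous_Gamma_line (sub_pos.2 hn) (-1)
    refine (Continuous.mul ?_ ?_).aestronglyMeasurable
    · convert h1 using 3; simp
    · convert h2 using 3; push_cast; ring
  · set s : ℂ := σ + u * Complex.I with hs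
    have hre : s.re = σ := by simp [hs]
    have him : s.im = u := by simp [hs]
    have hs0 : s ≠ 0 := fun h => by simp [h] at hre; linarith
    have hs1 : s + 1 ≠ 0 := fun h => by
      have := congrArg Complex.re h
      simp [hre] at this; linarith
    have hG : Complex.Gamma s = Complex.Gamma (s + 2) / (s * (s + 1)) := by
      rw [show s + 2 = s + 1 + 1 by ring, Complex.Gamma_add_one _ hs1, Complex.Gamma_add_one _ hs0]
      field_simp
    have hA : ‖Complex.Gamma (s + 2)‖ ≤ Real.Gamma (σ + 2) := by
      have := norm_Gamma_le (s := s + 2) (by simp [hre]; linarith)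
      simpa [hre] using this
    have hB : ‖Complex.Gamma (n - s)‖ ≤ Real.Gamma (n - σ) := by
      have := norm_Gamma_le (s := n - s) (by simp [hre]; linarith)
      simpa [hre] using this
    have hsq : ‖s‖ ^ 2 = σ ^ 2 + u ^ 2 := by
      rw [Complex.sq_norm, Complex.normSq_apply, hre, him]; ring
    have hle : ‖s‖ ≤ ‖s + 1‖ := by
      rw [← sq_le_sq₀ (norm_nonneg _) (norm_nonneg _), hsq, Complex.sq_norm, Complex.normSq_apply]
      simp only [Complex.add_re, Complex.one_re, Complex.add_im, Complex.one_im, hre, him]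
      nlinarith
    have hpos : 0 < ‖s‖ := norm_pos_iff.2 hs0
    rw [norm_mul, hG, norm_div, norm_mul]
    have e : (σ ^ 2)⁻¹ * (1 + (u / σ) ^ 2)⁻¹ = (‖s‖ * ‖s‖)⁻¹ := by
      rw [← sq, hsq, ← mul_inv]
      congr 1
      field_simp
    rw [mul_assoc (_ * _), e, div_mul_eq_mul_div, div_eq_mul_inv]
    gcongr

theorem integrableOn_pow_mul_exp_neg_mul (k : ℕ) {r : ℝ} (hr : 0 < r) :
    IntegrableOn (fun t : ℝ => t ^ k * Real.exp (-(r * t))) (Set.Ioi 0) := by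
  have := integrableOn_rpow_mul_exp_neg_mul_rpow (s := k) (p := 1) (b := r)
    (by have : (0 : ℝ) ≤ k := k.cast_nonneg
        linarith) one_pos hr
  simpa using this

theorem integral_pow_mul_exp_neg_mul (k : ℕ) {r : ℝ} (hr : 0 < r) :
    ∫ t in Set.Ioi (0 : ℝ), t ^ k * Real.exp (-(r * t)) = k.factorial / r ^ (k + 1) := by
  have := Real.integral_rpow_mul_exp_neg_mul_Ioi (a := k + 1) (r := r) (by positivity) hr
  rw [Real.Gamma_nat_eq_factorial] at this
  simp only [add_sub_cancel_right, Real.rpow_natCast] at this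
  rw [this, ← Nat.cast_add_one, Real.rpow_natCast]
  simp [div_eq_inv_mul]

/-- The function `x ↦ (1 + x)⁻ⁿ`, whose Mellin transform is a beta function. -/
def invOnePlusPow (n : ℕ) (x : ℝ) : ℂ := ((1 / (1 + x) ^ n : ℝ) : ℂ)

theorem Gamma_mul_invOnePlusPow {n : ℕ} (hn : 0 < n) {x : ℝ} (hx : 0 < x) :
    Complex.Gamma n * invOnePlusPow n x =
      ∫ w in Set.Ioi (0 : ℝ), (w : ℂ) ^ ((n : ℂ) - 1) * Complex.exp (-((1 + x : ℝ) * w)) := by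
  rw [Complex.integral_cpow_mul_exp_neg_mul_Ioi (by simpa using hn) (by linarith), invOnePlusPow,
    Complex.cpow_natCast, mul_comm]
  push_cast
  simp

/-- In absolute value the `x`-integral is `Γ(Re s) w^{-Re s}`, which leaves a Gamma integral with
exponent `n - Re s`; this is where both edges of the strip are needed. -/
theorem integrable_mellin_kernel {n : ℕ} {s : ℂ} (h₀ : 0 < s.re) (hs : s.re < n) :
    Integrable (fun q : ℝ × ℝ => (q.1 : ℂ) ^ (s - 1) *
      ((q.2 : ℂ) ^ ((n : ℂ) - 1) * Complex.exp (-((1 + q.1 : ℝ) * q.2))))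
      ((volume.restrict (Set.Ioi 0)).prod (volume.restrict (Set.Ioi 0))) := by
  have hm : Measurable (fun q : ℝ × ℝ => (q.1 : ℂ) ^ (s - 1) *
      ((q.2 : ℂ) ^ ((n : ℂ) - 1) * Complex.exp (-((1 + q.1 : ℝ) * q.2)))) := by fun_prop
  have hnorm : ∀ x w : ℝ, 0 < x → 0 < w → ‖(x : ℂ) ^ (s - 1) *
      ((w : ℂ) ^ ((n : ℂ) - 1) * Complex.exp (-((1 + x : ℝ) * w)))‖ =
      (w ^ ((n : ℝ) - 1) * Real.exp (-w)) * (x ^ (s.re - 1) * Real.exp (-(w * x))) := by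
    intro x w hx hw
    rw [norm_mul, norm_mul, Complex.norm_cpow_eq_rpow_re_of_pos hx,
      Complex.norm_cpow_eq_rpow_re_of_pos hw, Complex.norm_exp]
    have : (-(((1 + x : ℝ) : ℂ) * w)).re = -w + -(w * x) := by
      rw [← Complex.ofReal_mul, ← Complex.ofReal_neg, Complex.ofReal_re]; ring
    rw [this, Real.exp_add]
    simp
    ring
  rw [integrable_prod_iff' hm.aestronglyMeasurable]
  constructor
  · filter_upwards [ae_restrict_mem measurableSet_Ioi] with w hw
    have h1 : IntegrableOn (fun x : ℝ => x ^ (s.re - 1) * Real.exp (-(w * x))) (Set.Ioi 0) := by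
      simpa using integrableOn_rpow_mul_exp_neg_mul_rpow (s := s.re - 1) (p := 1) (b := w)
        (by linarith) one_pos hw
    refine (h1.const_mul (w ^ ((n : ℝ) - 1) * Real.exp (-w))).mono' ?_ ?_
    · exact (hm.comp (measurable_id.prodMk measurable_const)).aestronglyMeasurable
    · filter_upwards [ae_restrict_mem measurableSet_Ioi] with x hx
      exact (hnorm x w hx hw).le
  · have h2 : IntegrableOn (fun w : ℝ => w ^ ((n : ℝ) - 1 - s.re) * Real.exp (-w))
        (Set.Ioi 0) := by
      simpa using integrableOn_rpow_mul_exp_neg_mul_rpow (s := (n : ℝ) - 1 - s.re) (p := 1) (b := 1)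
        (by linarith) one_pos one_pos
    refine (h2.mul_const (Real.Gamma s.re)).congr ?_
    filter_upwards [ae_restrict_mem measurableSet_Ioi] with w hw
    have hw' : (0 : ℝ) < w := hw
    rw [setIntegral_congr_fun measurableSet_Ioi fun x hx => hnorm x w hx hw, integral_const_mul,
      Real.integral_rpow_mul_exp_neg_mul_Ioi h₀ hw, one_div, Real.inv_rpow hw'.le,
      Real.rpow_sub hw', div_eq_mul_inv]
    ring

/-- The beta integral: write `Γ(n)(1 + x)⁻ⁿ` as a Gamma integral in `w` and integrate in `x` first,
which yields `Γ(s) w^{-s}` and then `Γ(n - s)`. Convergence is a by-product of Fubini. -/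
theorem mellin_invOnePlusPow {n : ℕ} (hn : 0 < n) {s : ℂ} (h₀ : 0 < s.re) (hs : s.re < n) :
    MellinConvergent (invOnePlusPow n) s ∧
      Complex.Gamma n * mellin (invOnePlusPow n) s = Complex.Gamma s * Complex.Gamma (n - s) := by
  have hint := integrable_mellin_kernel h₀ hs
  have hΓ : Complex.Gamma n ≠ 0 := Complex.Gamma_ne_zero_of_re_pos (by simpa using hn)
  have e : ∀ x ∈ Set.Ioi (0 : ℝ), ∫ w in Set.Ioi (0 : ℝ), (x : ℂ) ^ (s - 1) *
      ((w : ℂ) ^ ((n : ℂ) - 1) * Complex.exp (-((1 + x : ℝ) * w))) =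
      Complex.Gamma n * ((x : ℂ) ^ (s - 1) • invOnePlusPow n x) := by
    intro x hx
    rw [integral_const_mul, ← Gamma_mul_invOnePlusPow hn hx, smul_eq_mul]
    ring
  constructor
  · have h1 := hint.integral_prod_left
    have h2 : IntegrableOn (fun x : ℝ => Complex.Gamma n * ((x : ℂ) ^ (s - 1) • invOnePlusPow n x))
        (Set.Ioi 0) := by
      refine h1.congr ?_
      filter_upwards [ae_restrict_mem measurableSet_Ioi] with x hx
      exact e x hx
    refine (h2.const_mul (Complex.Gamma n)⁻¹).congr (Filter.Eventually.of_forall fun x => ?_)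
    simp [hΓ]
  · rw [mellin, ← integral_const_mul, ← setIntegral_congr_fun measurableSet_Ioi e,
      integral_integral_swap hint]
    have e2 : ∀ w ∈ Set.Ioi (0 : ℝ), ∫ x in Set.Ioi (0 : ℝ), (x : ℂ) ^ (s - 1) *
        ((w : ℂ) ^ ((n : ℂ) - 1) * Complex.exp (-((1 + x : ℝ) * w))) =
        Complex.Gamma s * ((w : ℂ) ^ ((n : ℂ) - s - 1) * Complex.exp (-((1 : ℝ) * w))) := by
      intro w hw
      have hw0 : (w : ℂ) ≠ 0 := by
        have : w ≠ 0 := ne_of_gt hw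
        exact_mod_cast this
      have : ∀ x : ℝ, (x : ℂ) ^ (s - 1) *
        ((w : ℂ) ^ ((n : ℂ) - 1) * Complex.exp (-((1 + x : ℝ) * w))) =
        ((w : ℂ) ^ ((n : ℂ) - 1) * Complex.exp (-w)) *
          ((x : ℂ) ^ (s - 1) * Complex.exp (-(w * x))) := by
        intro x
        rw [show (-(((1 + x : ℝ) : ℂ) * w)) = -w + -(w * x) by push_cast; ring, Complex.exp_add]
        ring
      simp_rw [this]
      rw [integral_const_mul, Complex.integral_cpow_mul_exp_neg_mul_Ioi h₀ hw, one_div,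
        Complex.inv_cpow _ _ (by
          rw [Complex.arg_ofReal_of_nonneg (le_of_lt hw)]; exact Real.pi_pos.ne),
        show (n : ℂ) - s - 1 = (n - 1) - s by ring, Complex.cpow_sub (n - 1) s hw0,
        Complex.ofReal_one, one_mul, div_eq_mul_inv]
      ring
    rw [setIntegral_congr_fun measurableSet_Ioi e2, integral_const_mul,
      Complex.integral_cpow_mul_exp_neg_mul_Ioi (by simpa using hs) one_pos]
    simp

/-- The Mellin-Barnes representation of `(1 + x)⁻ⁿ`. -/
theorem integral_barnes {n : ℕ} (hn : 0 < n) {τ : ℝ} (h₀ : τ < 0) (hτ : -n < τ) {x : ℝ}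
    (hx : 0 < x) :
    ∫ u : ℝ, Complex.Gamma (-(τ + u * Complex.I)) * Complex.Gamma (n + (τ + u * Complex.I)) *
      (x : ℂ) ^ (τ + u * Complex.I : ℂ) =
      2 * Real.pi * Complex.Gamma n * invOnePlusPow n x := by
  have hΓ : Complex.Gamma n ≠ 0 := Complex.Gamma_ne_zero_of_re_pos (by simpa using hn)
  have hm : ∀ u : ℝ, mellin (invOnePlusPow n) ((-τ : ℝ) + u * Complex.I) =
      (Complex.Gamma n)⁻¹ * (Complex.Gamma ((-τ : ℝ) + u * Complex.I) *
        Complex.Gamma ((n : ℝ) - ((-τ : ℝ) + u * Complex.I))) := by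
    intro u
    have := (mellin_invOnePlusPow hn (s := (-τ : ℝ) + u * Complex.I) (by simpa using h₀)
      (by simp; linarith)).2
    rw [Complex.ofReal_natCast, ← this]
    field_simp
  have hinv := mellinInv_mellin_eq (-τ) (invOnePlusPow n) hx
    (mellin_invOnePlusPow hn (s := (-τ : ℝ)) (by simpa using h₀) (by simp; linarith)).1
    (by
      refine ((integrable_Gamma_mul_Gamma (σ := -τ) (n := n) (by linarith) (by linarith)).const_mul
        (Complex.Gamma n)⁻¹).congr (Filter.Eventually.of_forall fun u => ?_)
      exact (hm u).symm)
    (by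
      refine Complex.continuous_ofReal.continuousAt.comp (ContinuousAt.div ?_ ?_ ?_)
      · fun_prop
      · fun_prop
      · positivity)
  rw [← hinv, mellinInv]
  simp_rw [hm]
  -- Mellin inversion uses `x^{-s}` on the line `Re s = -τ`, whereas the Barnes variable is `-s`;
  -- hence the reflection `u ↦ -u`.
  rw [← integral_neg_eq_self]
  simp only [smul_eq_mul]
  have : ∀ u : ℝ, (x : ℂ) ^ (-(((-τ : ℝ) : ℂ) + u * Complex.I)) *
      ((Complex.Gamma n)⁻¹ * (Complex.Gamma ((-τ : ℝ) + u * Complex.I) *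
        Complex.Gamma ((n : ℝ) - ((-τ : ℝ) + u * Complex.I)))) = (Complex.Gamma n)⁻¹ *
      (Complex.Gamma (-(τ + (-u : ℝ) * Complex.I)) *
        Complex.Gamma (n + (τ + (-u : ℝ) * Complex.I)) *
      (x : ℂ) ^ (τ + (-u : ℝ) * Complex.I : ℂ)) := by
    intro u
    rw [show -(((-τ : ℝ) : ℂ) + u * Complex.I) = τ + (-u : ℝ) * Complex.I by push_cast; ring,
      show ((-τ : ℝ) : ℂ) + u * Complex.I = -(τ + (-u : ℝ) * Complex.I) by push_cast; ring]
    push_cast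
    rw [sub_neg_eq_add]
    ring
  simp_rw [this]
  rw [integral_const_mul, Complex.real_smul]
  have hpi : (Real.pi : ℂ) ≠ 0 := by exact_mod_cast Real.pi_ne_zero
  have key : ∀ z : ℂ, z = 2 * Real.pi * Complex.Gamma n *
      (((1 / (2 * Real.pi) : ℝ) : ℂ) * ((Complex.Gamma n)⁻¹ * z)) := by
    intro z
    push_cast
    field_simp
  exact key _

/-- The Mellin-Barnes integrand of `integral_barnes`. -/
def barnesKernel (n : ℕ) (τ x u : ℝ) : ℂ :=
  Complex.Gamma (-(τ + u * Complex.I)) * Complex.Gamma (n + (τ + u * Complex.I)) *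
    (x : ℂ) ^ (τ + u * Complex.I : ℂ)

theorem continuous_ofReal_cpow_line {x : ℝ} (hx : 0 < x) (τ : ℝ) :
    Continuous fun u : ℝ => (x : ℂ) ^ (τ + u * Complex.I : ℂ) := by
  have : (x : ℂ) ≠ 0 := by exact_mod_cast hx.ne'
  exact Continuous.const_cpow (by fun_prop) (Or.inl this)

theorem integrable_barnesKernel {n : ℕ} {τ : ℝ} (h₀ : τ < 0) (hτ : -n < τ) {x : ℝ}
    (hx : 0 < x) : Integrable (barnesKernel n τ x) := by
  have h := (integrable_Gamma_mul_Gamma (σ := -τ) (n := n) (by linarith) (by linarith)).comp_neg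
  refine Integrable.mul_bdd (c := x ^ τ) ?_
    (continuous_ofReal_cpow_line hx τ).aestronglyMeasurable
    (Filter.Eventually.of_forall fun u => ?_)
  · refine h.congr (Filter.Eventually.of_forall fun u => ?_)
    push_cast
    congr 2 <;> ring
  · rw [Complex.norm_cpow_eq_rpow_re_of_pos hx]
    simp

theorem barnesKernel_mul {n : ℕ} {τ x v u : ℝ} (hx : 0 < x) (hv : 0 < v) :
    barnesKernel n τ (x * v) u = barnesKernel n τ x u * (v : ℂ) ^ (τ + u * Complex.I : ℂ) := by
  rw [barnesKernel, barnesKernel, Complex.ofReal_mul,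
    Complex.mul_cpow_ofReal_nonneg hx.le hv.le]
  ring

/-- Only `Γ(a + s + t)` couples the two variables. Its Euler integral in `v` contributes `v^s v^t`,
so after Fubini the contour integral is a product of two Barnes integrals, at `xv` and `yv`. The
value is the same for every pair of separating lines. -/
theorem meijerLine_eq {k n : ℕ} (hn : 0 < n) {x y : ℝ} (hx : 0 < x) (hy : 0 < y) {p : ℝ × ℝ}
    (hp : IsSeparating (k + 1) 0 (1 - n) 0 0 p) :
    meijerLine (k + 1) 0 (1 - n) 0 0 x y p =
      ((Real.Gamma n * ∫ v in Set.Ioi (0 : ℝ),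
        v ^ k * Real.exp (-v) / ((1 + x * v) * (1 + y * v) ^ n) : ℝ) : ℂ) := by
  obtain ⟨σ, τ⟩ := p
  obtain ⟨h1, h2, h3, h4, h5⟩ := hp
  simp only at h1 h2 h3 h4 h5
  let E : ℝ × ℝ → ℝ → ℂ := fun u v =>
    (v : ℂ) ^ ((k + 1 + (σ + u.1 * Complex.I) + (τ + u.2 * Complex.I) : ℂ) - 1) *
      Complex.exp (-((1 : ℝ) * v))
  let B : ℝ × ℝ → ℂ := fun u => barnesKernel 1 σ x u.1 * barnesKernel n τ y u.2
  have hB : Integrable B := by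
    exact (integrable_barnesKernel h2 (by push_cast; linarith) hx).mul_prod
      (integrable_barnesKernel h4 (by linarith) hy)
  have hker : ∀ u : ℝ × ℝ, meijerKernel (k + 1) 0 (1 - n) 0 0 x y (σ + u.1 * Complex.I)
      (τ + u.2 * Complex.I) = ∫ v in Set.Ioi (0 : ℝ), B u * E u v := by
    intro u
    rw [integral_const_mul, Complex.integral_cpow_mul_exp_neg_mul_Ioi _ one_pos]
    · simp only [meijerKernel, B, barnesKernel]
      push_cast
      simp only [zero_sub, sub_zero, div_one, Complex.one_cpow, one_mul,
        sub_sub_cancel]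
      ring
    · simp; linarith
  have hint : Integrable (Function.uncurry fun u v => B u * E u v)
      ((volume : Measure (ℝ × ℝ)).prod (volume.restrict (Set.Ioi 0))) := by
    -- Integrability at `0` requires `k + σ + τ > -1`, which is exactly the separation condition for
    -- `Γ(a + s + t)`.
    have hg : IntegrableOn (fun v : ℝ => v ^ ((k : ℝ) + σ + τ) * Real.exp (-v))
        (Set.Ioi 0) := by
      simpa using integrableOn_rpow_mul_exp_neg_mul_rpow (s := (k : ℝ) + σ + τ) (p := 1) (b := 1)
        (by linarith) one_pos one_pos
    have hEm : Measurable (Function.uncurry E) := by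
      simp only [E, Function.uncurry_def]
      fun_prop
    refine (hB.norm.mul_prod hg).mono'
      (hB.aestronglyMeasurable.comp_fst.mul hEm.aestronglyMeasurable) ?_
    have hae : ∀ᵐ q : (ℝ × ℝ) × ℝ ∂((volume : Measure (ℝ × ℝ)).prod (volume.restrict (Set.Ioi 0))),
        0 < q.2 := Measure.quasiMeasurePreserving_snd.ae (ae_restrict_mem measurableSet_Ioi)
    filter_upwards [hae] with q hq
    simp only [Function.uncurry_def, E]
    rw [norm_mul, norm_mul ((q.2 : ℂ) ^ _), Complex.norm_cpow_eq_rpow_re_of_pos hq,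
      Complex.norm_exp]
    refine le_of_eq ?_
    congr 3
    · simp; ring
    · rw [← Complex.ofReal_mul, ← Complex.ofReal_neg, Complex.ofReal_re, one_mul]
  rw [meijerLine]
  simp only [hker]
  rw [integral_integral_swap hint]
  have hinner : ∀ v ∈ Set.Ioi (0 : ℝ), ∫ u : ℝ × ℝ, B u * E u v =
      ((2 * Real.pi) ^ 2 * Real.Gamma n *
        (v ^ k * Real.exp (-v) / ((1 + x * v) * (1 + y * v) ^ n)) : ℝ) := by
    intro v hv
    have hv' : (0 : ℝ) < v := hv
    have hv0 : (v : ℂ) ≠ 0 := by exact_mod_cast hv'.ne'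
    have e : ∀ u : ℝ × ℝ, B u * E u v = ((v : ℂ) ^ k * Complex.exp (-v)) *
        (barnesKernel 1 σ (x * v) u.1 * barnesKernel n τ (y * v) u.2) := by
      intro u
      simp only [B, E]
      rw [barnesKernel_mul hx hv, barnesKernel_mul hy hv,
        show (k + 1 + (σ + u.1 * Complex.I) + (τ + u.2 * Complex.I) : ℂ) - 1 =
          k + (σ + u.1 * Complex.I) + (τ + u.2 * Complex.I) by ring,
        Complex.cpow_add _ _ hv0, Complex.cpow_add _ _ hv0, Complex.cpow_natCast]
      simp only [Complex.ofReal_one, one_mul]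
      ring
    simp_rw [e]
    have hb1 := integral_barnes (n := 1) one_pos h2 (by push_cast; linarith) (mul_pos hx hv')
    have hb2 := integral_barnes hn h4 (by linarith) (mul_pos hy hv')
    rw [integral_const_mul, Measure.volume_eq_prod, integral_prod_mul]
    simp only [barnesKernel]
    rw [hb1, hb2, invOnePlusPow, invOnePlusPow, ← Complex.ofReal_natCast n, Complex.Gamma_ofReal]
    push_cast
    simp only [Complex.Gamma_one, pow_one]
    have n1 : (1 + x * v : ℂ) ≠ 0 := by
      have : 1 + x * v ≠ 0 := by positivity
      exact_mod_cast this
    have n2 : (1 + y * v : ℂ) ≠ 0 := by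
      have : 1 + y * v ≠ 0 := by positivity
      exact_mod_cast this
    field_simp
  rw [setIntegral_congr_fun measurableSet_Ioi hinner, integral_complex_ofReal, integral_const_mul]
  have hpi : (Real.pi : ℂ) ≠ 0 := by exact_mod_cast Real.pi_ne_zero
  rw [mul_assoc ((2 * Real.pi) ^ 2), Complex.ofReal_mul, ← mul_assoc]
  convert! one_mul _
  push_cast
  field_simp

/-- The two-variable Meijer function of the first-hop capacity as a real integral. -/
theorem meijerG2_eq {k n : ℕ} (hn : 0 < n) {x y : ℝ} (hx : 0 < x) (hy : 0 < y) :
    meijerG2 (k + 1) 0 (1 - n) 0 0 x y = Real.Gamma n * ∫ v in Set.Ioi (0 : ℝ),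
        v ^ k * Real.exp (-v) / ((1 + x * v) * (1 + y * v) ^ n) := by
  have hex : ∃ p, IsSeparating (k + 1) 0 (1 - n) 0 0 p := by
    have h1 : (1 : ℝ) ≤ n := by exact_mod_cast hn
    have h2 : (0 : ℝ) ≤ k := k.cast_nonneg
    -- The lower bounds on the abscissae are `-1` and `-n`, and on their sum `-(k + 1)`; small
    -- negative values satisfy all of them.
    refine ⟨(-1 / 4, -1 / 4), ?_, ?_, ?_, ?_, ?_⟩ <;> simp only <;> linarith
  rw [meijerG2, meijerLine_eq hn hx hy (Classical.epsilon_spec hex), Complex.ofReal_re]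

/-! ### Real integral identities that collapse the binomial sum -/

theorem integrableOn_pow_mul_exp_mul_of_le_one (k : ℕ) {z : ℝ} (hz : 0 < z) {g : ℝ → ℝ}
    (hg : Measurable g) (hg₁ : ∀ y, 0 < y → |g y| ≤ 1) :
    IntegrableOn (fun y => y ^ k * Real.exp (-(z * y)) * g y) (Set.Ioi 0) := by
  refine (integrableOn_pow_mul_exp_neg_mul k hz).mul_bdd (c := 1) hg.aestronglyMeasurable ?_
  filter_upwards [ae_restrict_mem measurableSet_Ioi] with y hy
  exact hg₁ y hy

theorem abs_one_div_pow_le_one {r y : ℝ} (hr : 0 ≤ r) (hy : 0 < y) (n : ℕ) :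
    |1 / (1 + r * y) ^ n| ≤ 1 := by
  have : 1 ≤ 1 + r * y := by nlinarith [mul_nonneg hr hy.le]
  rw [abs_of_nonneg (by positivity)]
  exact div_le_one_of_le₀ (one_le_pow₀ this) (by positivity)

theorem integral_exp_neg_mul {c : ℝ} (hc : 0 < c) :
    ∫ t in Set.Ioi (0 : ℝ), Real.exp (-(c * t)) = 1 / c := by
  simpa using integral_pow_mul_exp_neg_mul 0 hc

theorem integrableOn_exp_neg_mul {c : ℝ} (hc : 0 < c) :
    IntegrableOn (fun t => Real.exp (-(c * t))) (Set.Ioi 0) := by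
  simpa using integrableOn_pow_mul_exp_neg_mul 0 hc

/-- Both sides are iterated integrals of `z^{k+1}/k! · y^k · exp(-z(y + w + ryw))`, whose exponent
is symmetric in `y` and `w`: integrating out `w` gives the left side, integrating out `y` the right.
-/
theorem integral_pow_mul_exp_div_one_add (k : ℕ) {z r : ℝ} (hz : 0 < z) (hr : 0 ≤ r) :
    z ^ k / k.factorial * ∫ y in Set.Ioi (0 : ℝ), y ^ k * Real.exp (-(z * y)) * (1 / (1 + r * y)) =
      ∫ s in Set.Ioi (0 : ℝ), Real.exp (-(z * s)) * (1 / (1 + r * s) ^ (k + 1)) := by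
  let c : ℝ := z ^ (k + 1) / k.factorial
  let f : ℝ → ℝ → ℝ := fun y w => c * y ^ k * Real.exp (-(z * y)) * Real.exp (-(z * (1 + r * y) * w))
  have hf : ∀ y w, f y w = c * Real.exp (-(z * w)) * (y ^ k * Real.exp (-(z * (1 + r * w) * y))) := by
    intro y w
    simp only [f]
    have he : Real.exp (-(z * y)) * Real.exp (-(z * (1 + r * y) * w)) =
        Real.exp (-(z * w)) * Real.exp (-(z * (1 + r * w) * y)) := by
      rw [← Real.exp_add, ← Real.exp_add]
      ring_nf
    linear_combination c * y ^ k * he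
  have hpos : ∀ y : ℝ, 0 < y → 0 < z * (1 + r * y) := fun y hy => by positivity
  have hc : 0 < c := by positivity
  have h := integral_integral_swap_of_nonneg (μ := volume.restrict (Set.Ioi 0))
    (ν := volume.restrict (Set.Ioi 0)) (f := f)
    (by
      refine Measurable.aestronglyMeasurable ?_
      simp only [Function.uncurry_def, f]
      fun_prop)
    (by
      filter_upwards [ae_restrict_mem measurableSet_Ioi] with y hy
      refine Filter.Eventually.of_forall fun w => ?_
      have : (0 : ℝ) < y := hy
      positivity)
    (by
      refine Filter.Eventually.of_forall fun w => ?_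
      filter_upwards [ae_restrict_mem measurableSet_Ioi] with y hy
      have : (0 : ℝ) < y := hy
      positivity)
    (by
      filter_upwards [ae_restrict_mem measurableSet_Ioi] with y hy
      exact (integrableOn_exp_neg_mul (hpos y hy)).const_mul _)
    (by
      filter_upwards [ae_restrict_mem measurableSet_Ioi] with w hw
      simp_rw [hf]
      exact (integrableOn_pow_mul_exp_neg_mul k (hpos w hw)).const_mul _)
  rw [← integral_const_mul]
  convert h using 1
  · refine setIntegral_congr_fun measurableSet_Ioi fun y hy => ?_
    have hp := hpos y hy
    have : (1 + r * y) ≠ 0 := (pos_of_mul_pos_right hp hz.le).ne'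
    simp only [f, c]
    rw [integral_const_mul, integral_exp_neg_mul hp, pow_succ]
    field_simp
  · refine setIntegral_congr_fun measurableSet_Ioi fun w hw => ?_
    have hp := hpos w hw
    have : (1 + r * w) ≠ 0 := (pos_of_mul_pos_right hp hz.le).ne'
    simp only [hf]
    rw [integral_const_mul, integral_pow_mul_exp_neg_mul k hp, mul_pow]
    simp only [c]
    field_simp

/-- The density of the gamma distribution of shape `m + 1` and scale `a`. -/
def gammaDensity (a : ℝ) (m : ℕ) (u : ℝ) : ℝ :=
  u ^ m * Real.exp (-(1 / a * u)) / (a ^ (m + 1) * m.factorial)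

theorem measurable_gammaDensity (a : ℝ) (m : ℕ) : Measurable (gammaDensity a m) := by
  unfold gammaDensity
  fun_prop

theorem gammaDensity_nonneg {a u : ℝ} (ha : 0 < a) (hu : 0 < u) (m : ℕ) :
    0 ≤ gammaDensity a m u := by
  unfold gammaDensity
  positivity

theorem gammaDensity_laplace {a y : ℝ} (ha : 0 < a) (hy : 0 < y) (m l : ℕ) :
    IntegrableOn (fun u => gammaDensity a m u * (u ^ l * Real.exp (-(y * u)))) (Set.Ioi 0) ∧
    ∫ u in Set.Ioi (0 : ℝ), gammaDensity a m u * (u ^ l * Real.exp (-(y * u))) =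
      a ^ l * (Real.Gamma ((m + 1 : ℕ) + l) / Real.Gamma (m + 1 : ℕ)) /
        (1 + a * y) ^ (m + 1 + l) := by
  have e : ∀ u, gammaDensity a m u * (u ^ l * Real.exp (-(y * u))) =
      1 / (a ^ (m + 1) * m.factorial) * (u ^ (m + l) * Real.exp (-((1 / a + y) * u))) := by
    intro u
    rw [gammaDensity, show -((1 / a + y) * u) = -(1 / a * u) + -(y * u) by ring, Real.exp_add]
    ring
  have hp : 0 < 1 / a + y := by positivity
  simp_rw [e]
  refine ⟨(integrableOn_pow_mul_exp_neg_mul _ hp).const_mul _, ?_⟩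
  rw [integral_const_mul, integral_pow_mul_exp_neg_mul _ hp,
    show (((m + 1 : ℕ) : ℝ) + l) = ((m + l : ℕ) : ℝ) + 1 by push_cast; ring, Nat.cast_succ,
    Real.Gamma_nat_eq_factorial, Real.Gamma_nat_eq_factorial,
    show 1 / a + y = (1 + a * y) / a by field_simp, div_pow]
  have : (1 + a * y) ≠ 0 := by positivity
  field_simp
  ring

/-- This is `integral_pow_mul_exp_div_one_add` at `z = 1 + u`, averaged over `u` with the gamma law
of shape `m + 1` and scale `a`. On the left `(1 + u)^k` expands binomially and each moment `u^l
e^{-yu}` produces one summand; on the right only the Laplace transform `(1 + as)^{-(m+1)}` appears.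
-/
theorem integral_laplace_shift (k m : ℕ) {a r : ℝ} (ha : 0 < a) (hr : 0 ≤ r) :
    1 / (k.factorial : ℝ) * ∑ l ∈ Finset.range (k + 1), (k.choose l : ℝ) *
      (a ^ l * (Real.Gamma ((m + 1 : ℕ) + l) / Real.Gamma (m + 1 : ℕ)) *
        ∫ y in Set.Ioi (0 : ℝ), y ^ k * Real.exp (-y) / ((1 + r * y) * (1 + a * y) ^ (m + 1 + l))) =
      ∫ s in Set.Ioi (0 : ℝ), Real.exp (-s) / ((1 + r * s) ^ (k + 1) * (1 + a * s) ^ (m + 1)) := by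
  let d := gammaDensity a m
  let F : ℝ → ℝ → ℝ := fun y u => d u * ((1 + u) ^ k / k.factorial *
    (y ^ k * Real.exp (-((1 + u) * y)) * (1 / (1 + r * y))))
  let G : ℝ → ℝ → ℝ := fun u s => d u * (Real.exp (-((1 + u) * s)) * (1 / (1 + r * s) ^ (k + 1)))
  have hd : Measurable d := measurable_gammaDensity a m
  have hd0 : ∀ u : ℝ, 0 < u → 0 ≤ d u := fun u hu => gammaDensity_nonneg ha hu m
  have hmr : ∀ n : ℕ, Measurable fun y : ℝ => 1 / (1 + r * y) ^ n := fun n => by fun_prop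
  have hexp : ∀ u y : ℝ, Real.exp (-((1 + u) * y)) = Real.exp (-y) * Real.exp (-(y * u)) := by
    intro u y
    rw [← Real.exp_add]; ring_nf
  have hF : ∀ y u, F y u = 1 / k.factorial * (y ^ k * Real.exp (-y) * (1 / (1 + r * y))) *
      ∑ l ∈ Finset.range (k + 1), (k.choose l : ℝ) * (d u * (u ^ l * Real.exp (-(y * u)))) := by
    intro y u
    simp only [F]
    rw [hexp, add_comm 1 u, add_pow, Finset.sum_div, Finset.sum_mul, Finset.mul_sum,
      Finset.mul_sum]
    refine Finset.sum_congr rfl fun l _ => ?_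
    rw [one_pow]
    ring
  have hFint : ∀ y : ℝ, 0 < y → IntegrableOn (F y) (Set.Ioi 0) := by
    intro y hy
    simp_rw [funext (hF y)]
    exact (integrable_finsetSum _ fun l _ =>
      ((gammaDensity_laplace ha hy m l).1.const_mul _)).const_mul _
  have h1 := integral_integral_swap_of_nonneg (μ := volume.restrict (Set.Ioi 0))
    (ν := volume.restrict (Set.Ioi 0)) (f := F)
    (by
      refine Measurable.aestronglyMeasurable ?_
      simp only [Function.uncurry_def, F]
      fun_prop)
    (by
      filter_upwards [ae_restrict_mem measurableSet_Ioi] with y hy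
      filter_upwards [ae_restrict_mem measurableSet_Ioi] with u hu
      have h1 : (0 : ℝ) < y := hy
      have h2 : (0 : ℝ) < u := hu
      have := hd0 u hu
      positivity)
    (by
      filter_upwards [ae_restrict_mem measurableSet_Ioi] with u hu
      filter_upwards [ae_restrict_mem measurableSet_Ioi] with y hy
      have h1 : (0 : ℝ) < y := hy
      have h2 : (0 : ℝ) < u := hu
      have := hd0 u hu
      positivity)
    (by
      filter_upwards [ae_restrict_mem measurableSet_Ioi] with y hy
      exact hFint y hy)
    (by
      filter_upwards [ae_restrict_mem measurableSet_Ioi] with u hu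
      have h2 : (0 : ℝ) < 1 + u := by linarith [show (0 : ℝ) < u from hu]
      refine ((integrableOn_pow_mul_exp_mul_of_le_one k h2 (hmr 1) fun y hy =>
        abs_one_div_pow_le_one hr hy 1).const_mul (d u * ((1 + u) ^ k / k.factorial))).congr ?_
      exact Filter.Eventually.of_forall fun y => by simp only [F, pow_one]; ring)
  have h2 := integral_integral_swap_of_nonneg (μ := volume.restrict (Set.Ioi 0))
    (ν := volume.restrict (Set.Ioi 0)) (f := G)
    (by
      refine Measurable.aestronglyMeasurable ?_
      simp only [Function.uncurry_def, G]
      fun_prop)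
    (by
      filter_upwards [ae_restrict_mem measurableSet_Ioi] with u hu
      filter_upwards [ae_restrict_mem measurableSet_Ioi] with y hy
      have h1 : (0 : ℝ) < y := hy
      have := hd0 u hu
      positivity)
    (by
      filter_upwards [ae_restrict_mem measurableSet_Ioi] with y hy
      filter_upwards [ae_restrict_mem measurableSet_Ioi] with u hu
      have h1 : (0 : ℝ) < y := hy
      have := hd0 u hu
      positivity)
    (by
      filter_upwards [ae_restrict_mem measurableSet_Ioi] with u hu
      have h2 : (0 : ℝ) < 1 + u := by linarith [show (0 : ℝ) < u from hu]
      refine ((integrableOn_pow_mul_exp_mul_of_le_one 0 h2 (hmr (k + 1)) fun y hy =>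
        abs_one_div_pow_le_one hr hy (k + 1)).const_mul (d u)).congr ?_
      exact Filter.Eventually.of_forall fun y => by simp only [G, pow_zero]; ring)
    (by
      filter_upwards [ae_restrict_mem measurableSet_Ioi] with s hs
      refine ((gammaDensity_laplace ha hs m 0).1.const_mul
        (Real.exp (-s) * (1 / (1 + r * s) ^ (k + 1)))).congr ?_
      exact Filter.Eventually.of_forall fun u => by simp only [G, hexp, d, pow_zero]; ring)
  have hmid : ∫ u in Set.Ioi (0 : ℝ), ∫ y in Set.Ioi (0 : ℝ), F y u =
      ∫ u in Set.Ioi (0 : ℝ), ∫ s in Set.Ioi (0 : ℝ), G u s := by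
    refine setIntegral_congr_fun measurableSet_Ioi fun u hu => ?_
    have h2 : (0 : ℝ) < 1 + u := by linarith [show (0 : ℝ) < u from hu]
    simp only [F, G]
    rw [integral_const_mul, integral_const_mul, integral_const_mul,
      integral_pow_mul_exp_div_one_add k h2 hr]
  rw [hmid, h2] at h1
  convert h1 using 1
  · rw [Finset.mul_sum]
    have hterm : ∀ l, IntegrableOn (fun y : ℝ =>
        y ^ k * Real.exp (-y) / ((1 + r * y) * (1 + a * y) ^ (m + 1 + l))) (Set.Ioi 0) := by
      intro l
      refine (integrableOn_pow_mul_exp_mul_of_le_one k one_pos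
        (g := fun y => 1 / (1 + r * y) ^ 1 * (1 / (1 + a * y) ^ (m + 1 + l))) (by fun_prop)
        fun y hy => ?_).congr (Filter.Eventually.of_forall fun y => ?_)
      · rw [abs_mul]
        exact mul_le_one₀ (abs_one_div_pow_le_one hr hy 1) (abs_nonneg _)
          (abs_one_div_pow_le_one ha.le hy _)
      · simp only [one_mul, pow_one]
        rw [one_div_mul_one_div, mul_one_div]
    have : ∀ l, 1 / (k.factorial : ℝ) * ((k.choose l : ℝ) *
      (a ^ l * (Real.Gamma ((m + 1 : ℕ) + l) / Real.Gamma (m + 1 : ℕ)) *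
        ∫ y in Set.Ioi (0 : ℝ), y ^ k * Real.exp (-y) / ((1 + r * y) * (1 + a * y) ^ (m + 1 + l))))
        = ∫ y in Set.Ioi (0 : ℝ), 1 / (k.factorial : ℝ) * (k.choose l : ℝ) *
      (a ^ l * (Real.Gamma ((m + 1 : ℕ) + l) / Real.Gamma (m + 1 : ℕ))) *
         (y ^ k * Real.exp (-y) / ((1 + r * y) * (1 + a * y) ^ (m + 1 + l))) := by
      intro l
      rw [integral_const_mul]
      ring
    simp_rw [this]
    rw [← integral_finsetSum _ fun l _ => (hterm l).const_mul _]
    refine setIntegral_congr_fun measurableSet_Ioi fun y hy => ?_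
    simp only [hF]
    rw [integral_const_mul, integral_finsetSum _ fun l _ =>
      (gammaDensity_laplace ha hy m l).1.const_mul _, Finset.mul_sum]
    refine Finset.sum_congr rfl fun l _ => ?_
    rw [integral_const_mul, (gammaDensity_laplace ha hy m l).2]
    field_simp
  · refine setIntegral_congr_fun measurableSet_Ioi fun s hs => ?_
    have : ∀ u, G u s = (Real.exp (-s) * (1 / (1 + r * s) ^ (k + 1))) *
        (d u * (u ^ 0 * Real.exp (-(s * u)))) := by
      intro u
      simp only [G, hexp, pow_zero]; ring
    simp_rw [this]
    rw [integral_const_mul, (gammaDensity_laplace ha hs m 0).2]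
    have h3 : Real.Gamma (m + 1 : ℕ) ≠ 0 := (Real.Gamma_pos_of_pos (by positivity)).ne'
    simp only [pow_zero, Nat.cast_zero, add_zero, div_self h3, one_mul]
    rw [mul_assoc, one_div_mul_one_div, mul_one_div]

/-! ### Closed forms as Laplace-type integrals -/

/-- The Laplace transform `ξ ↦ det(I + ξ D)⁻¹`, `D = diag(ρ)`. -/
def detLaplace {M : ℕ} (ρ : Fin M → ℝ) (ξ : ℝ) : ℝ := ∏ i, 1 / (1 + ξ * ρ i)

theorem det_one_add_smul_diagonal_inv {M : ℕ} (ρ : Fin M → ℝ) (ξ : ℝ) :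
    (Matrix.det (1 + ξ • Matrix.diagonal ρ))⁻¹ = detLaplace ρ ξ := by
  have : (1 + ξ • Matrix.diagonal ρ) = Matrix.diagonal fun m => 1 + ξ * ρ m := by
    rw [← Matrix.diagonal_one, ← Matrix.diagonal_smul, Matrix.diagonal_add]
    rfl
  rw [this, Matrix.det_diagonal, ← Finset.prod_inv_distrib, detLaplace]
  simp

theorem detLaplace_eq_charSum {M : ℕ} (hM : 0 < M) (ρ : Fin M → ℝ) (hρ : ∀ m, 0 < ρ m) {ξ : ℝ}
    (hξ : 0 ≤ ξ) : detLaplace ρ ξ = charSum ρ fun a j => 1 / (1 + a * ξ) ^ j := by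
  rw [← det_one_add_smul_diagonal_inv, isCharCoeff_charCoeff hM ρ hρ ξ hξ, charSum]
  simp only [mul_one_div, mul_comm ξ]

theorem detLaplace_nonneg {M : ℕ} (ρ : Fin M → ℝ) (hρ : ∀ m, 0 < ρ m) {ξ : ℝ} (hξ : 0 ≤ ξ) :
    0 ≤ detLaplace ρ ξ :=
  Finset.prod_nonneg fun i _ => by have := hρ i; positivity

theorem measurable_detLaplace {M : ℕ} (ρ : Fin M → ℝ) : Measurable (detLaplace ρ) := by
  unfold detLaplace
  fun_prop

theorem abs_detLaplace_le_one {M : ℕ} (ρ : Fin M → ℝ) (hρ : ∀ m, 0 < ρ m) {ξ : ℝ} (hξ : 0 < ξ) :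
    |detLaplace ρ ξ| ≤ 1 := by
  rw [abs_of_nonneg (detLaplace_nonneg ρ hρ hξ.le)]
  refine Finset.prod_le_one (fun i _ => ?_) fun i _ => ?_
  · have := hρ i
    positivity
  · have := abs_one_div_pow_le_one (hρ i).le hξ 1
    rw [pow_one, mul_comm] at this
    exact (le_abs_self _).trans this

/-- Only positive `a` and exponents `j ≥ 1` occur in the sum. The shift to `j + 1` matches the gamma
shape `m + 1` used above. -/
theorem charSum_congr {M : ℕ} (ρ : Fin M → ℝ) (hρ : ∀ m, 0 < ρ m) {f g : ℝ → ℕ → ℝ}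
    (h : ∀ a j, 0 < a → f a (j + 1) = g a (j + 1)) : charSum ρ f = charSum ρ g := by
  refine Finset.sum_congr rfl fun a ha => Finset.sum_congr rfl fun j hj => ?_
  obtain ⟨m, -, hm⟩ := Finset.mem_image.1 ha
  obtain ⟨i, rfl⟩ := Nat.exists_eq_add_of_le' (Finset.mem_Icc.1 hj).1
  rw [h a i (hm ▸ hρ m)]

theorem charSum_const_mul {M : ℕ} (ρ : Fin M → ℝ) (c : ℝ) (f : ℝ → ℕ → ℝ) :
    charSum ρ (fun a j => c * f a j) = c * charSum ρ f := by
  simp only [charSum, Finset.mul_sum, mul_left_comm]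

theorem charSum_sum {M : ℕ} (ρ : Fin M → ℝ) {ι : Type*} (s : Finset ι) (f : ι → ℝ → ℕ → ℝ) :
    charSum ρ (fun a j => ∑ l ∈ s, f l a j) = ∑ l ∈ s, charSum ρ (f l) := by
  simp only [charSum, Finset.mul_sum]
  rw [Finset.sum_comm (s := s)]
  exact Finset.sum_congr rfl fun a _ => Finset.sum_comm

/-- Inside the integral the partial fractions recombine into the determinant. The bound on `h` makes
every summand integrable. -/
theorem charSum_integral {M : ℕ} (hM : 0 < M) (ρ : Fin M → ℝ) (hρ : ∀ m, 0 < ρ m) {h : ℝ → ℝ}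
    (hh : Measurable h) (h₁ : ∀ y, 0 < y → |h y| ≤ 1) :
    (charSum ρ fun a j => ∫ y in Set.Ioi (0 : ℝ), Real.exp (-y) * h y * (1 / (1 + a * y) ^ j)) =
      ∫ y in Set.Ioi (0 : ℝ), Real.exp (-y) * h y * detLaplace ρ y := by
  have hint : ∀ a ∈ distinctValues ρ, ∀ j, IntegrableOn
      (fun y => Real.exp (-y) * h y * (1 / (1 + a * y) ^ j)) (Set.Ioi 0) := by
    intro a ha j
    obtain ⟨m, -, hm⟩ := Finset.mem_image.1 ha
    refine (integrableOn_pow_mul_exp_mul_of_le_one 0 one_pos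
      (g := fun y => h y * (1 / (1 + a * y) ^ j)) (by fun_prop) fun y hy => ?_).congr
      (Filter.Eventually.of_forall fun y => ?_)
    · rw [abs_mul]
      exact mul_le_one₀ (h₁ y hy) (abs_nonneg _)
        (abs_one_div_pow_le_one (hm ▸ hρ m).le hy _)
    · simp only [one_mul, pow_zero, mul_assoc]
  have e : ∀ y ∈ Set.Ioi (0 : ℝ), Real.exp (-y) * h y * detLaplace ρ y =
      ∑ a ∈ distinctValues ρ, ∑ j ∈ Finset.Icc 1 (multiplicity ρ a),
        charCoeff ρ a j * (Real.exp (-y) * h y * (1 / (1 + a * y) ^ j)) := by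
    intro y hy
    rw [detLaplace_eq_charSum hM ρ hρ (le_of_lt hy), ← charSum_const_mul]
    rfl
  rw [setIntegral_congr_fun measurableSet_Ioi e, integral_finsetSum]
  · refine Finset.sum_congr rfl fun a ha => ?_
    rw [integral_finsetSum]
    · simp only [integral_const_mul]
    · exact fun j _ => (hint a ha j).const_mul _
  · exact fun a ha => integrable_finsetSum _ fun j _ => (hint a ha j).const_mul _

/-- A geometric sum. It produces the factor `(1 - (1 + ry)^{-N}) / y` that the Frullani formula
yields on the probabilistic side. -/
theorem sum_div_one_add_pow (N : ℕ) {r s : ℝ} (hr : 0 < r) (hs : 0 < s) :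
    ∑ k ∈ Finset.range N, r * (1 / (1 + r * s) ^ (k + 1)) = (1 - 1 / (1 + r * s) ^ N) / s := by
  have h : 1 + r * s ≠ 0 := by positivity
  induction N with
  | zero => simp
  | succ n ih =>
    rw [Finset.sum_range_succ, ih]
    field_simp
    ring

/-- Used twice: with `r = ρ₁` for the capacity and with `r = 0` for the mean. -/
theorem integral_first_hop {M : ℕ} (hM : 0 < M) (ρ : Fin M → ℝ) (hρ : ∀ m, 0 < ρ m) (k : ℕ)
    {r : ℝ} (hr : 0 ≤ r) :
    (charSum ρ fun a j => 1 / (k.factorial : ℝ) * ∑ l ∈ Finset.range (k + 1), (k.choose l : ℝ) *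
      (a ^ l * (Real.Gamma (j + l) / Real.Gamma j) *
        ∫ y in Set.Ioi (0 : ℝ), y ^ k * Real.exp (-y) / ((1 + r * y) * (1 + a * y) ^ (j + l)))) =
      ∫ y in Set.Ioi (0 : ℝ), Real.exp (-y) * (1 / (1 + r * y) ^ (k + 1)) * detLaplace ρ y := by
  rw [← charSum_integral hM ρ hρ (by fun_prop) fun y hy => abs_one_div_pow_le_one hr hy _]
  refine charSum_congr ρ hρ fun a j ha => ?_
  rw [integral_laplace_shift k j ha hr]
  refine setIntegral_congr_fun measurableSet_Ioi fun y _ => ?_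
  rw [mul_assoc, one_div_mul_one_div, mul_one_div]

theorem integrableOn_first_hop {M : ℕ} (ρ : Fin M → ℝ) (hρ : ∀ m, 0 < ρ m) (k : ℕ)
    {r : ℝ} (hr : 0 ≤ r) : IntegrableOn
      (fun y => Real.exp (-y) * (1 / (1 + r * y) ^ (k + 1)) * detLaplace ρ y) (Set.Ioi 0) := by
  have hm := measurable_detLaplace ρ
  refine (integrableOn_pow_mul_exp_mul_of_le_one 0 one_pos
    (g := fun y => 1 / (1 + r * y) ^ (k + 1) * detLaplace ρ y) (by fun_prop) fun y hy => ?_).congr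
    (Filter.Eventually.of_forall fun y => ?_)
  · rw [abs_mul]
    exact mul_le_one₀ (abs_one_div_pow_le_one hr hy _) (abs_nonneg _)
      (abs_detLaplace_le_one ρ hρ hy)
  · simp only [one_mul, pow_zero, mul_assoc]

theorem capacityTerm1_eq (N : ℕ) {M : ℕ} (hM : 0 < M) {ρ₁ : ℝ} (hρ₁ : 0 < ρ₁) (ρ : Fin M → ℝ)
    (hρ : ∀ m, 0 < ρ m) :
    capacityTerm1 N ρ₁ ρ = 1 / (2 * Real.log 2) * ∫ y in Set.Ioi (0 : ℝ),
      Real.exp (-y) * ((1 - 1 / (1 + ρ₁ * y) ^ N) / y) * detLaplace ρ y := by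
  have hk : ∀ k ∈ Finset.range N, 1 / (k.factorial : ℝ) *
    ∑ l ∈ Finset.range (k + 1), (k.choose l : ℝ) *
      charSum ρ (fun a j => a ^ l / Real.Gamma j *
        meijerG2 ((k : ℝ) + 1) 0 (1 - (j : ℝ) - (l : ℝ)) 0 0 ρ₁ a) =
      ∫ y in Set.Ioi (0 : ℝ), Real.exp (-y) * (1 / (1 + ρ₁ * y) ^ (k + 1)) * detLaplace ρ y := by
    intro k _
    rw [← integral_first_hop hM ρ hρ k hρ₁.le]
    simp_rw [← charSum_const_mul]
    rw [← charSum_sum, ← charSum_const_mul]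
    refine charSum_congr ρ hρ fun a j ha => ?_
    congr 1
    refine Finset.sum_congr rfl fun l _ => ?_
    -- The Meijer parameter is `1 - n` with `n` the total exponent of `1 + ay`; the resulting `Γ(n)`
    -- supplies the numerator of the Gamma ratio.
    rw [show (1 : ℝ) - ((j + 1 : ℕ) : ℝ) - l = 1 - ((j + 1 + l : ℕ) : ℝ) by push_cast; ring,
      meijerG2_eq (by omega) hρ₁ ha]
    push_cast
    ring
  rw [capacityTerm1, Finset.sum_congr rfl hk, ← integral_finsetSum _ fun k _ =>
    integrableOn_first_hop ρ hρ k hρ₁.le, div_eq_mul_one_div, mul_comm ρ₁, mul_assoc,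
    ← integral_const_mul]
  congr 1
  refine setIntegral_congr_fun measurableSet_Ioi fun y hy => ?_
  rw [← sum_div_one_add_pow N hρ₁ hy, Finset.mul_sum, Finset.mul_sum, Finset.sum_mul]
  refine Finset.sum_congr rfl fun k _ => ?_
  ring

/-- The substitution `t = ay`; the parameters are such that `1 + t` carries the exponent `-n`. -/
theorem tricomiPsi_eq (k n : ℕ) {a : ℝ} (ha : 0 < a) :
    tricomiPsi ((k : ℝ) + 1) ((k : ℝ) - n + 2) (1 / a) = 1 / k.factorial * (a ^ (k + 1) *
      ∫ y in Set.Ioi (0 : ℝ), y ^ k * Real.exp (-y) / (1 + a * y) ^ n) := by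
  rw [tricomiPsi, Real.Gamma_nat_eq_factorial, one_div (k.factorial : ℝ)]
  congr 1
  have := integral_comp_mul_left_Ioi (fun t : ℝ => t ^ k * Real.exp (-(1 / a * t)) / (1 + t) ^ n) 0 ha
  rw [mul_zero, smul_eq_mul] at this
  rw [eq_comm, inv_mul_eq_div, div_eq_iff ha.ne'] at this
  convert this using 1
  · refine setIntegral_congr_fun measurableSet_Ioi fun t ht => ?_
    have ht' : (0 : ℝ) < 1 + t := by linarith [show (0 : ℝ) < t from ht]
    rw [add_sub_cancel_right, Real.rpow_natCast,
      show (k : ℝ) - n + 2 - (k + 1) - 1 = -(n : ℝ) by ring, Real.rpow_neg ht'.le,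
      Real.rpow_natCast]
    ring
  · rw [pow_succ, mul_right_comm, ← integral_const_mul]
    congr 1
    refine integral_congr_ae (Filter.Eventually.of_forall fun y => ?_)
    simp only
    rw [← mul_assoc (1 / a), one_div_mul_cancel ha.ne', one_mul, mul_pow]
    ring

theorem meanTerm1_eq (N : ℕ) {M : ℕ} (hM : 0 < M) (ρ₁ : ℝ) (ρ : Fin M → ℝ)
    (hρ : ∀ m, 0 < ρ m) :
    meanTerm1 N ρ₁ ρ = ρ₁ * (N * ∫ y in Set.Ioi (0 : ℝ), Real.exp (-y) * detLaplace ρ y) := by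
  have hk : ∀ k ∈ Finset.range N, ∑ l ∈ Finset.range (k + 1), (k.choose l : ℝ) *
    charSum ρ (fun a j => Real.Gamma ((j : ℝ) + (l : ℝ)) / Real.Gamma j *
      a ^ ((l : ℤ) - (k : ℤ) - 1) *
        tricomiPsi ((k : ℝ) + 1) ((k : ℝ) - (j : ℝ) - (l : ℝ) + 2) (1 / a)) =
      ∫ y in Set.Ioi (0 : ℝ), Real.exp (-y) * detLaplace ρ y := by
    intro k _
    -- At `r = 0` the right side no longer depends on `k`, so the sum over `k` contributes just the
    -- factor `N`.
    have h := integral_first_hop hM ρ hρ k le_rfl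
    simp only [zero_mul, add_zero, one_pow, div_one, mul_one, one_mul] at h
    rw [← h]
    simp_rw [← charSum_const_mul]
    rw [← charSum_sum]
    refine charSum_congr ρ hρ fun a j ha => ?_
    rw [Finset.mul_sum]
    refine Finset.sum_congr rfl fun l _ => ?_
    rw [show (k : ℝ) - ((j + 1 : ℕ) : ℝ) - l + 2 = k - ((j + 1 + l : ℕ) : ℝ) + 2 by
      push_cast; ring, tricomiPsi_eq k _ ha,
      show (l : ℤ) - k - 1 = (l : ℤ) - ((k + 1 : ℕ) : ℤ) by push_cast; ring,
      zpow_sub₀ ha.ne', zpow_natCast, zpow_natCast]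
    generalize (∫ y in Set.Ioi (0 : ℝ), y ^ k * Real.exp (-y) / (1 + a * y) ^ (j + 1 + l)) = I
    field_simp
  rw [meanTerm1, Finset.sum_congr rfl hk, Finset.sum_const, Finset.card_range, nsmul_eq_mul]

/-- The shift `t = y + 1/r = (1 + ry)/r` moves the incomplete Gamma integrals to the half-line and
cancels `e^{1/r}`; the rest is the geometric sum. -/
theorem capacityTerm2_eq (N : ℕ) {r : ℝ} (hr : 0 < r) :
    capacityTerm2 N r = 1 / (2 * Real.log 2) * ∫ y in Set.Ioi (0 : ℝ),
      Real.exp (-y) * ((1 - 1 / (1 + r * y) ^ N) / y) := by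
  have hk : ∀ k ∈ Finset.range N, Real.exp (1 / r) * (1 / r ^ k * upperGamma (-(k : ℝ)) (1 / r)) =
      ∫ y in Set.Ioi (0 : ℝ), Real.exp (-y) * (r * (1 / (1 + r * y) ^ (k + 1))) := by
    intro k _
    have h := (measurePreserving_add_right volume (1 / r)).setIntegral_preimage_emb
      (measurableEmbedding_addRight (1 / r))
      (fun t : ℝ => Real.exp (-t) * t ^ (-(k : ℝ) - 1)) (Set.Ioi (1 / r))
    have hpre : (fun y => y + 1 / r) ⁻¹' Set.Ioi (1 / r) = Set.Ioi 0 := by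
      ext y
      simp
    rw [hpre] at h
    rw [upperGamma, ← h, ← integral_const_mul, ← integral_const_mul]
    refine setIntegral_congr_fun measurableSet_Ioi fun y hy => ?_
    have hy' : (0 : ℝ) < y := hy
    have hp : 0 < y + 1 / r := by positivity
    rw [show -(k : ℝ) - 1 = -((k + 1 : ℕ) : ℝ) by push_cast; ring, Real.rpow_neg hp.le,
      Real.rpow_natCast, show -(y + 1 / r) = -y + -(1 / r) by ring, Real.exp_add,
      show y + 1 / r = (1 + r * y) / r by field_simp; ring, div_pow, Real.exp_neg (1 / r)]
    have hE := (Real.exp_pos (1 / r)).ne'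
    have : 1 + r * y ≠ 0 := by positivity
    field_simp
    ring
  have hint : ∀ k, IntegrableOn (fun y => Real.exp (-y) * (r * (1 / (1 + r * y) ^ (k + 1))))
      (Set.Ioi 0) := by
    intro k
    refine ((integrableOn_pow_mul_exp_mul_of_le_one 0 one_pos
      (g := fun y => 1 / (1 + r * y) ^ (k + 1)) (by fun_prop) fun y hy =>
      abs_one_div_pow_le_one hr.le hy _).const_mul r).congr
      (Filter.Eventually.of_forall fun y => ?_)
    simp only [one_mul, pow_zero]
    ring
  rw [capacityTerm2, div_eq_mul_one_div, mul_comm (Real.exp _), mul_assoc, Finset.mul_sum,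
    Finset.sum_congr rfl hk, ← integral_finsetSum _ fun k _ => hint k]
  congr 1
  refine setIntegral_congr_fun measurableSet_Ioi fun y hy => ?_
  rw [← sum_div_one_add_pow N hr hy, Finset.mul_sum]

/-! ### The complex Gaussian law -/

instance : IsProbabilityMeasure complexGaussian :=
  Measure.isProbabilityMeasure_map Complex.measurableEquivRealProd.symm.measurable.aemeasurable

theorem integral_complexGaussian {E : Type*} [NormedAddCommGroup E] [NormedSpace ℝ E]
    (f : ℂ → E) : ∫ z, f z ∂complexGaussian =
      ∫ q : ℝ × ℝ, f ⟨q.1, q.2⟩ ∂((gaussianReal 0 (1 / 2)).prod (gaussianReal 0 (1 / 2))) := by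
  rw [complexGaussian, integral_map_equiv]
  rfl

/-- Variance `1/2` makes the density `π^{-1/2} e^{-x²}`. The product of two such factors is the
Laplace transform of an exponential law of mean one, the law of `‖z‖²`. -/
theorem integral_exp_neg_mul_sq_gaussianReal {c : ℝ} (hc : 0 ≤ c) :
    ∫ x, Real.exp (-(c * x ^ 2)) ∂gaussianReal 0 (1 / 2) = √(1 / (1 + c)) := by
  rw [integral_gaussianReal_eq_integral_smul (by norm_num)]
  have : ∀ x : ℝ, gaussianPDFReal 0 (1 / 2) x • Real.exp (-(c * x ^ 2)) =
      (√Real.pi)⁻¹ * Real.exp (-(1 + c) * x ^ 2) := by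
    intro x
    have hv : ((1 / 2 : NNReal) : ℝ) = 1 / 2 := by norm_num
    rw [gaussianPDFReal, hv, mul_one_div_cancel two_ne_zero, smul_eq_mul, mul_assoc,
      ← Real.exp_add, mul_right_comm, mul_one_div_cancel two_ne_zero, one_mul]
    congr 2
    ring
  simp_rw [this]
  rw [integral_const_mul, integral_gaussian, Real.sqrt_div Real.pi_pos.le,
    Real.sqrt_div zero_le_one, Real.sqrt_one]
  have := (Real.sqrt_pos.2 Real.pi_pos).ne'
  field_simp

theorem integral_exp_neg_mul_sq_complexGaussian {c : ℝ} (hc : 0 ≤ c) :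
    ∫ z, Real.exp (-(c * ‖z‖ ^ 2)) ∂complexGaussian = 1 / (1 + c) := by
  rw [integral_complexGaussian]
  have : ∀ q : ℝ × ℝ, Real.exp (-(c * ‖(⟨q.1, q.2⟩ : ℂ)‖ ^ 2)) =
      Real.exp (-(c * q.1 ^ 2)) * Real.exp (-(c * q.2 ^ 2)) := by
    intro q
    rw [Complex.sq_norm, Complex.normSq_mk, ← Real.exp_add]
    ring_nf
  simp_rw [this]
  rw [integral_prod_mul (fun x : ℝ => Real.exp (-(c * x ^ 2))) fun x : ℝ => Real.exp (-(c * x ^ 2)),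
    integral_exp_neg_mul_sq_gaussianReal hc, Real.mul_self_sqrt (by positivity)]

theorem integrable_sq_gaussianReal {v : NNReal} : Integrable (fun x : ℝ => x ^ 2) (gaussianReal 0 v) :=
  (memLp_id_gaussianReal 2).integrable_sq

theorem integral_sq_gaussianReal {v : NNReal} : ∫ x, x ^ 2 ∂gaussianReal 0 v = v := by
  have h := variance_id_gaussianReal (μ := 0) (v := v)
  rw [variance_eq_integral aemeasurable_id] at h
  simpa using h

theorem integrable_normSq_complexGaussian : Integrable (fun z => ‖z‖ ^ 2) complexGaussian := by
  rw [complexGaussian, integrable_map_equiv]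
  have h := integrable_sq_gaussianReal (v := 1 / 2)
  refine ((h.comp_fst (gaussianReal 0 (1 / 2))).add (h.comp_snd (gaussianReal 0 (1 / 2)))).congr
    (Filter.Eventually.of_forall fun q => ?_)
  simp only [Function.comp_apply, Pi.add_apply]
  rw [Complex.sq_norm, Complex.normSq_apply]
  simp [sq]

theorem integral_normSq_complexGaussian : ∫ z, ‖z‖ ^ 2 ∂complexGaussian = 1 := by
  have h := integrable_sq_gaussianReal (v := 1 / 2)
  rw [integral_complexGaussian]
  have : ∀ q : ℝ × ℝ, ‖(⟨q.1, q.2⟩ : ℂ)‖ ^ 2 = q.1 ^ 2 + q.2 ^ 2 := by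
    intro q
    rw [Complex.sq_norm, Complex.normSq_mk]
    ring
  simp_rw [this]
  rw [integral_add (h.comp_fst _) (h.comp_snd _), integral_fun_fst (fun x : ℝ => x ^ 2),
    integral_fun_snd (fun x : ℝ => x ^ 2), integral_sq_gaussianReal]
  norm_num

theorem charFun_complexGaussian (t : ℂ) :
    charFun complexGaussian t = Complex.exp (-(‖t‖ ^ 2 / 4 : ℝ)) := by
  rw [charFun_apply, integral_complexGaussian]
  have : ∀ q : ℝ × ℝ, Complex.exp ((inner ℝ (⟨q.1, q.2⟩ : ℂ) t : ℝ) * Complex.I) =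
      Complex.exp (t.re * q.1 * Complex.I) * Complex.exp (t.im * q.2 * Complex.I) := by
    intro q
    rw [Complex.inner, ← Complex.exp_add]
    congr 1
    simp
    ring
  simp_rw [this]
  rw [integral_prod_mul (fun x : ℝ => Complex.exp (t.re * x * Complex.I)) fun x : ℝ =>
    Complex.exp (t.im * x * Complex.I), ← charFun_apply_real, ← charFun_apply_real,
    charFun_gaussianReal, charFun_gaussianReal, ← Complex.exp_add, Complex.sq_norm,
    Complex.normSq_apply]
  congr 1
  push_cast
  ring

/-- A unit linear combination of independent `CN(0,1)` variables is `CN(0,1)`. -/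
theorem map_sum_mul_complexGaussian {N : ℕ} (c : Fin N → ℂ) (hc : ∑ n, ‖c n‖ ^ 2 = 1) :
    (Measure.pi fun _ : Fin N => complexGaussian).map (fun w => ∑ n, c n * w n) =
      complexGaussian := by
  have hind : iIndepFun (fun n (w : Fin N → ℂ) => c n * w n)
      (Measure.pi fun _ : Fin N => complexGaussian) :=
    iIndepFun_pi (X := fun n z => c n * z) fun n => by fun_prop
  have hm : ∀ n, Measurable fun w : Fin N → ℂ => c n * w n := fun n =>
    (measurable_pi_apply n).const_mul _
  have : IsProbabilityMeasure ((Measure.pi fun _ : Fin N => complexGaussian).map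
      (fun w => ∑ n, c n * w n)) := Measure.isProbabilityMeasure_map
        (Finset.measurable_sum _ fun n _ => hm n).aemeasurable
  -- The characteristic function of `CN(0,1)` at `t` is `exp(-‖t‖²/4)`, so only the weights `‖c n‖²`
  -- survive in the product, and they add up to one.
  refine Measure.ext_of_charFun ?_
  rw [hind.charFun_map_fun_sum_eq_prod fun n => (hm n).aemeasurable]
  ext t
  have hn : ∀ n, charFun ((Measure.pi fun _ : Fin N => complexGaussian).map
      fun w => c n * w n) t = Complex.exp (-(‖c n‖ ^ 2 * ‖t‖ ^ 2 / 4 : ℝ)) := by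
    intro n
    have h1 : (Measure.pi fun _ : Fin N => complexGaussian).map (fun w => c n * w n) =
        complexGaussian.map fun z => c n * z := by
      have h := Measure.map_map (μ := Measure.pi fun _ : Fin N => complexGaussian)
        (g := fun z => c n * z) (by fun_prop) (measurable_pi_apply n)
      rw [show (fun w : Fin N → ℂ => w n) = Function.eval n from rfl,
        (measurePreserving_eval (fun _ : Fin N => complexGaussian) n).map_eq] at h
      rw [h]
      rfl
    rw [h1, charFun_apply, integral_map (by fun_prop) (by fun_prop)]
    have h2 : ∀ z : ℂ, inner ℝ (c n * z) t = inner ℝ z ((starRingEnd ℂ) (c n) * t) := by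
      intro z
      rw [Complex.inner, Complex.inner, map_mul]
      congr 1
      ring
    simp_rw [h2]
    rw [← charFun_apply, charFun_complexGaussian, norm_mul, RCLike.norm_conj, mul_pow]
  rw [Finset.prod_apply, Finset.prod_congr rfl fun n _ => hn n, ← Complex.exp_sum,
    charFun_complexGaussian]
  congr 1
  rw [Finset.sum_neg_distrib, ← Complex.ofReal_sum, ← Finset.sum_div, ← Finset.sum_mul, hc, one_mul]

theorem sqNorm_nonneg {N : ℕ} (v : Fin N → ℂ) : 0 ≤ sqNorm v :=
  Finset.sum_nonneg fun _ _ => by positivity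

theorem measurable_sqNorm {N : ℕ} : Measurable (sqNorm (N := N)) := by
  unfold sqNorm
  fun_prop

/-- Dividing by `√(sqNorm v)` makes `v†w` a unit combination of the entries, hence `CN(0,1)`. The
answer does not depend on `v`, which is what decouples the interference from `h₁`. -/
theorem integral_exp_neg_projection {N : ℕ} {v : Fin N → ℂ} (hv : sqNorm v ≠ 0) {c : ℝ}
    (hc : 0 ≤ c) :
    ∫ w, Real.exp (-(c * (‖cdot v w‖ ^ 2 / sqNorm v)))
      ∂(Measure.pi fun _ : Fin N => complexGaussian) = 1 / (1 + c) := by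
  have hpos : 0 < sqNorm v := (sqNorm_nonneg v).lt_of_ne' hv
  let d : Fin N → ℂ := fun n => star (v n) / (Real.sqrt (sqNorm v) : ℂ)
  have hd : ∑ n, ‖d n‖ ^ 2 = 1 := by
    simp only [d, norm_div, norm_star, Complex.norm_real, div_pow, Real.norm_eq_abs, sq_abs,
      Real.sq_sqrt hpos.le]
    rw [← Finset.sum_div]
    exact div_self hv
  have he : ∀ w, ‖cdot v w‖ ^ 2 / sqNorm v = ‖∑ n, d n * w n‖ ^ 2 := by
    intro w
    have : ∑ n, d n * w n = cdot v w / (Real.sqrt (sqNorm v) : ℂ) := by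
      simp only [d, cdot, dotProduct, Finset.sum_div, Pi.star_apply, div_mul_eq_mul_div]
    rw [this, norm_div, Complex.norm_real, div_pow, Real.norm_eq_abs, sq_abs,
      Real.sq_sqrt hpos.le]
  simp_rw [he]
  have hm : Measurable fun w : Fin N → ℂ => ∑ n, d n * w n :=
    Finset.measurable_sum _ fun n _ => (measurable_pi_apply n).const_mul _
  have h := integral_map (μ := Measure.pi fun _ : Fin N => complexGaussian) hm.aemeasurable
    (f := fun z : ℂ => Real.exp (-(c * ‖z‖ ^ 2))) (by fun_prop)
  rw [map_sum_mul_complexGaussian d hd, integral_exp_neg_mul_sq_complexGaussian hc] at h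
  exact h.symm

theorem integral_exp_neg_sqNorm {N : ℕ} {s : ℝ} (hs : 0 ≤ s) :
    ∫ v, Real.exp (-(s * sqNorm v)) ∂(Measure.pi fun _ : Fin N => complexGaussian) =
      1 / (1 + s) ^ N := by
  have : ∀ v : Fin N → ℂ, Real.exp (-(s * sqNorm v)) = ∏ n, Real.exp (-(s * ‖v n‖ ^ 2)) := by
    intro v
    rw [← Real.exp_sum, sqNorm, Finset.mul_sum, Finset.sum_neg_distrib]
  simp_rw [this]
  rw [integral_fintype_prod_eq_pow (fun z : ℂ => Real.exp (-(s * ‖z‖ ^ 2))),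
    integral_exp_neg_mul_sq_complexGaussian hs, Fintype.card_fin, one_div_pow]

theorem integrable_norm_sq_apply {N : ℕ} (n : Fin N) :
    Integrable (fun v : Fin N → ℂ => ‖v n‖ ^ 2) (Measure.pi fun _ : Fin N => complexGaussian) :=
  (measurePreserving_eval (fun _ : Fin N => complexGaussian) n).integrable_comp_of_integrable
    integrable_normSq_complexGaussian

theorem integrable_sqNorm {N : ℕ} :
    Integrable (sqNorm (N := N)) (Measure.pi fun _ : Fin N => complexGaussian) :=
  integrable_finsetSum _ fun n _ => integrable_norm_sq_apply n

theorem integral_sqNorm {N : ℕ} :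
    ∫ v, sqNorm v ∂(Measure.pi fun _ : Fin N => complexGaussian) = N := by
  have h : ∀ n : Fin N, ∫ v : Fin N → ℂ, ‖v n‖ ^ 2
      ∂(Measure.pi fun _ : Fin N => complexGaussian) = 1 := by
    intro n
    have h := integral_map (μ := Measure.pi fun _ : Fin N => complexGaussian)
      (measurable_pi_apply n).aemeasurable (f := fun z : ℂ => ‖z‖ ^ 2) (by fun_prop)
    rw [show (fun w : Fin N → ℂ => w n) = Function.eval n from rfl,
      (measurePreserving_eval (fun _ : Fin N => complexGaussian) n).map_eq,
      integral_normSq_complexGaussian] at h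
    exact h.symm
  simp only [sqNorm]
  rw [integral_finsetSum _ fun n _ => integrable_norm_sq_apply n]
  simp [h]

/-! ### The interference -/

theorem interference_nonneg {N M : ℕ} {ρ : Fin M → ℝ} (hρ : ∀ i, 0 < ρ i) (v : Fin N → ℂ)
    (q : Fin M → Fin N → ℂ) : 0 ≤ interference ρ v q :=
  Finset.sum_nonneg fun i _ => by
    have := sqNorm_nonneg v
    have := hρ i
    positivity

theorem measurable_cdot {N : ℕ} : Measurable fun p : (Fin N → ℂ) × (Fin N → ℂ) => cdot p.1 p.2 := by
  simp only [cdot, dotProduct, Pi.star_apply]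
  refine Finset.measurable_sum _ fun n _ => ?_
  have : Measurable (star : ℂ → ℂ) := continuous_star.measurable
  fun_prop

theorem measurable_interference {N M : ℕ} (ρ : Fin M → ℝ) :
    Measurable fun p : (Fin N → ℂ) × (Fin M → Fin N → ℂ) => interference ρ p.1 p.2 := by
  unfold interference
  refine Finset.measurable_sum _ fun i _ => ?_
  have h1 : Measurable fun p : (Fin N → ℂ) × (Fin M → Fin N → ℂ) => cdot p.1 (p.2 i) :=
    measurable_cdot.comp (measurable_fst.prodMk ((measurable_pi_apply i).comp measurable_snd))
  have h2 : Measurable fun p : (Fin N → ℂ) × (Fin M → Fin N → ℂ) => sqNorm p.1 :=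
    measurable_sqNorm.comp measurable_fst
  fun_prop

/-- The law of the interferer-relay channels. -/
def interfererLaw (N M : ℕ) : Measure (Fin M → Fin N → ℂ) :=
  Measure.pi fun _ => Measure.pi fun _ => complexGaussian

instance (N M : ℕ) : IsProbabilityMeasure (interfererLaw N M) := by
  unfold interfererLaw
  infer_instance

theorem integral_exp_neg_interference {N M : ℕ} {ρ : Fin M → ℝ} (hρ : ∀ i, 0 < ρ i)
    {v : Fin N → ℂ} (hv : sqNorm v ≠ 0) {t : ℝ} (ht : 0 ≤ t) :
    ∫ q, Real.exp (-(t * interference ρ v q)) ∂interfererLaw N M = detLaplace ρ t := by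
  have : ∀ q : Fin M → Fin N → ℂ, Real.exp (-(t * interference ρ v q)) =
      ∏ i, Real.exp (-(t * ρ i * (‖cdot v (q i)‖ ^ 2 / sqNorm v))) := by
    intro q
    rw [← Real.exp_sum, interference, Finset.mul_sum, ← Finset.sum_neg_distrib]
    congr 1
    refine Finset.sum_congr rfl fun i _ => ?_
    ring
  simp_rw [this]
  rw [interfererLaw, integral_fintype_prod_eq_prod (fun (i : Fin M) (w : Fin N → ℂ) =>
    Real.exp (-(t * ρ i * (‖cdot v w‖ ^ 2 / sqNorm v)))), detLaplace]
  exact Finset.prod_congr rfl fun i _ =>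
    integral_exp_neg_projection hv (mul_nonneg ht (hρ i).le)

/-- Integrate out the interferers first: for `v ≠ 0` their transform is independent of `v`. At `v =
0` division by zero makes the interference vanish and the formula would fail, so `φ` is required to
vanish there. -/
theorem integral_mul_exp_neg_interference {N M : ℕ} {ρ : Fin M → ℝ} (hρ : ∀ i, 0 < ρ i)
    {φ : (Fin N → ℂ) → ℝ} (hφ : Integrable φ (Measure.pi fun _ => complexGaussian))
    (hφ₀ : ∀ v, sqNorm v = 0 → φ v = 0) {t : ℝ} (ht : 0 ≤ t) :
    ∫ p : (Fin N → ℂ) × (Fin M → Fin N → ℂ), φ p.1 * Real.exp (-(t * interference ρ p.1 p.2))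
      ∂((Measure.pi fun _ => complexGaussian).prod (interfererLaw N M)) =
    (∫ v, φ v ∂(Measure.pi fun _ => complexGaussian)) * detLaplace ρ t := by
  have hm := measurable_interference (N := N) ρ
  rw [integral_prod, ← integral_mul_const]
  · refine integral_congr_ae (Filter.Eventually.of_forall fun v => ?_)
    simp only
    rw [integral_const_mul]
    by_cases hv : sqNorm v = 0
    · simp [hφ₀ v hv]
    · rw [integral_exp_neg_interference hρ hv ht]
  · refine (hφ.comp_fst _).mul_bdd (c := 1) (by fun_prop) (Filter.Eventually.of_forall fun p => ?_)
    rw [Real.norm_of_nonneg (Real.exp_pos _).le, Real.exp_le_one_iff]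
    have := mul_nonneg ht (interference_nonneg hρ p.1 p.2)
    linarith

/-! ### Laws of the channels -/

variable {Ω : Type*} [MeasurableSpace Ω] {μ : Measure Ω} {N M : ℕ} {h₁ h₂ : Ω → Fin N → ℂ}
  {hI : Fin M → Ω → Fin N → ℂ}

theorem IsRayleighChannel.map_relay_destination [IsProbabilityMeasure μ]
    (h : IsRayleighChannel μ h₁ h₂ hI) :
    μ.map h₂ = Measure.pi fun _ => complexGaussian := by
  have hi := h.indep.precomp (g := fun n : Fin N => Sum.inr (Sum.inl n))
    (fun a b hab => by simpa using hab)
  have := (iIndepFun_iff_map_fun_eq_pi_map fun n => (h.law₂ n).aemeasurable).1 hi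
  simp only [(h.law₂ _).map_eq] at this
  exact this

/-- The joint law is needed because `U₁` involves both `h₁` and the interferers. The independent
entries, indexed by a sum type, have a product law; splitting the sum and currying the pair index
bring it to this form. -/
theorem IsRayleighChannel.map_source_interferers [IsProbabilityMeasure μ]
    (h : IsRayleighChannel μ h₁ h₂ hI) :
    μ.map (fun ω => (h₁ ω, fun i => hI i ω)) =
      (Measure.pi fun _ => complexGaussian).prod (interfererLaw N M) := by
  let Y : (Fin N ⊕ (Fin M × Fin N)) → Ω → ℂ := fun k ω =>
    Sum.elim (h₁ ω) (fun q => hI q.1 ω q.2) k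
  have hlaw : ∀ k, HasLaw (Y k) complexGaussian μ := by
    rintro (n | ⟨i, n⟩)
    · exact h.law₁ n
    · exact h.lawI i n
  have hi : iIndepFun Y μ := by
    have := h.indep.precomp (g := Sum.map id Sum.inr) (by
      rw [Sum.map_injective]
      exact ⟨Function.injective_id, Sum.inr_injective⟩)
    convert this using 2 with k
    rcases k with n | q <;> rfl
  have hY := (iIndepFun_iff_map_fun_eq_pi_map fun k => (hlaw k).aemeasurable).1 hi
  simp only [(hlaw _).map_eq] at hY
  have hYm : AEMeasurable (fun ω k => Y k ω) μ := aemeasurable_pi_lambda _ fun k =>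
    (hlaw k).aemeasurable
  have h1 := (measurePreserving_sumPiEquivProdPi
    (fun _ : Fin N ⊕ (Fin M × Fin N) => complexGaussian)).map_eq
  have h2 : (Measure.pi fun _ : Fin M × Fin N => complexGaussian).map
      (MeasurableEquiv.curry (Fin M) (Fin N) ℂ) = interfererLaw N M := by
    have := Measure.infinitePi_map_curry (fun (_ : Fin M) (_ : Fin N) => complexGaussian)
    simpa only [Measure.infinitePi_eq_pi, interfererLaw] using this
  rw [← hY, AEMeasurable.map_map_of_aemeasurable (MeasurableEquiv.measurable _).aemeasurable hYm] at h1
  rw [← h2, ← Measure.map_id (μ := Measure.pi fun _ : Fin N => complexGaussian),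
    Measure.map_prod_map _ _ measurable_id (MeasurableEquiv.measurable _), ← h1,
    AEMeasurable.map_map_of_aemeasurable (by fun_prop) ((MeasurableEquiv.measurable _).comp_aemeasurable hYm)]
  rfl

/-! ### Expectations of `log (1 + γ)` and `γ` -/

/-- Since `1 - x ≤ e^{-x}`, the quotient `(1 - e^{-bs}) / s` stays below `b`, so there is no
singularity at `0`. -/
theorem integrableOn_log_kernel {A b : ℝ} (hA : 0 < A) (hb : 0 ≤ b) :
    IntegrableOn (fun s => Real.exp (-(A * s)) * ((1 - Real.exp (-(b * s))) / s)) (Set.Ioi 0) := by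
  refine (integrableOn_exp_neg_mul hA).mul_bdd (c := b)
    (Measurable.aestronglyMeasurable (by fun_prop)) ?_
  filter_upwards [ae_restrict_mem measurableSet_Ioi] with s hs
  have hs' : (0 : ℝ) < s := hs
  have h1 : Real.exp (-(b * s)) ≤ 1 := by
    rw [Real.exp_le_one_iff]
    have := mul_nonneg hb hs'.le
    linarith
  have h2 := Real.add_one_le_exp (-(b * s))
  rw [Real.norm_of_nonneg (div_nonneg (by linarith) hs'.le), div_le_iff₀ hs']
  linarith

/-- Frullani: the integrand is `∫_0^b e^{-(A+v)s} dv`, and exchanging the integrals leaves `∫_0^b dv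
/ (A + v)`. -/
theorem integral_log_kernel {A b : ℝ} (hA : 0 < A) (hb : 0 ≤ b) :
    ∫ s in Set.Ioi (0 : ℝ), Real.exp (-(A * s)) * ((1 - Real.exp (-(b * s))) / s) =
      Real.log (1 + b / A) := by
  have h := integral_integral_swap_of_nonneg (μ := volume.restrict (Set.Ioi 0))
    (ν := volume.restrict (Set.Ioc 0 b)) (f := fun s v => Real.exp (-((A + v) * s)))
    (by
      refine Measurable.aestronglyMeasurable ?_
      simp only [Function.uncurry_def]
      fun_prop)
    (Filter.Eventually.of_forall fun s => Filter.Eventually.of_forall fun v => (Real.exp_pos _).le)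
    (Filter.Eventually.of_forall fun s => Filter.Eventually.of_forall fun v => (Real.exp_pos _).le)
    (Filter.Eventually.of_forall fun s => (Continuous.integrableOn_Ioc (by fun_prop)))
    (by
      filter_upwards [ae_restrict_mem measurableSet_Ioc] with v hv
      exact integrableOn_exp_neg_mul (by linarith [hv.1]))
  have e₁ : ∀ s ∈ Set.Ioi (0 : ℝ), ∫ v in Set.Ioc 0 b, Real.exp (-((A + v) * s)) =
      Real.exp (-(A * s)) * ((1 - Real.exp (-(b * s))) / s) := by
    intro s hs
    have hs' : s ≠ 0 := ne_of_gt hs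
    rw [← intervalIntegral.integral_of_le hb, intervalIntegral.integral_eq_sub_of_hasDerivAt
      (f := fun v => -(Real.exp (-((A + v) * s)) / s))]
    · rw [show -((A + b) * s) = -(A * s) + -(b * s) by ring, Real.exp_add, add_zero]
      ring
    · intro v _
      have h1 : HasDerivAt (fun v : ℝ => -((A + v) * s)) (-(1 * s)) v :=
        (((hasDerivAt_id v).const_add A).mul_const s).neg
      refine (h1.exp.div_const s).fun_neg.congr_deriv ?_
      field_simp
    · exact Continuous.intervalIntegrable (by fun_prop) _ _
  have e₂ : ∀ v ∈ Set.Ioc 0 b, ∫ s in Set.Ioi (0 : ℝ), Real.exp (-((A + v) * s)) = (A + v)⁻¹ := by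
    intro v hv
    rw [integral_exp_neg_mul (by linarith [hv.1]), one_div]
  rw [setIntegral_congr_fun measurableSet_Ioi e₁, setIntegral_congr_fun measurableSet_Ioc e₂,
    ← intervalIntegral.integral_of_le hb, intervalIntegral.integral_eq_sub_of_hasDerivAt
      (f := fun v => Real.log (A + v))] at h
  · rw [h, add_zero, ← Real.log_div (by positivity) hA.ne', add_div, div_self hA.ne']
  · intro v hv
    rw [Set.uIcc_of_le hb] at hv
    have h1 : HasDerivAt (fun v : ℝ => A + v) 1 v := (hasDerivAt_id v).const_add A
    simpa using h1.log (by linarith [hv.1])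
  · refine ContinuousOn.intervalIntegrable (ContinuousOn.inv₀ (by fun_prop) fun v hv => ?_)
    rw [Set.uIcc_of_le hb] at hv
    linarith [hv.1]

section Expectations

variable {Ω : Type*} [MeasurableSpace Ω] {μ : Measure Ω} [IsProbabilityMeasure μ]

/-- The Frullani formula with `A = U + 1` and `b = Xr`, for each outcome. Positivity allows the
exchange without an integrability assumption on `X`: for fixed `s` the kernel is at most `1/s`. -/
theorem integral_log_one_add_ratio {X U : Ω → ℝ} (hX : AEMeasurable X μ) (hU : AEMeasurable U μ)
    (hX₀ : ∀ ω, 0 ≤ X ω) (hU₀ : ∀ ω, 0 ≤ U ω) {r : ℝ} (hr : 0 < r) :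
    ∫ ω, Real.log (1 + X ω * r / (U ω + 1)) ∂μ = ∫ s in Set.Ioi (0 : ℝ),
      ∫ ω, Real.exp (-((U ω + 1) * s)) * ((1 - Real.exp (-(X ω * r * s))) / s) ∂μ := by
  have hU₁ : ∀ ω, 0 < U ω + 1 := fun ω => by linarith [hU₀ ω]
  have hXr : ∀ ω, 0 ≤ X ω * r := fun ω => mul_nonneg (hX₀ ω) hr.le
  have hpos : ∀ ω s, 0 < s → 0 ≤ Real.exp (-((U ω + 1) * s)) *
      ((1 - Real.exp (-(X ω * r * s))) / s) := by
    intro ω s hs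
    have : Real.exp (-(X ω * r * s)) ≤ 1 := by
      rw [Real.exp_le_one_iff]
      linarith [mul_nonneg (hXr ω) hs.le]
    exact mul_nonneg (Real.exp_pos _).le (div_nonneg (by linarith) hs.le)
  have hXU : AEMeasurable (fun ω => (X ω, U ω)) μ := hX.prodMk hU
  rw [← integral_integral_swap_of_nonneg]
  · refine integral_congr_ae (Filter.Eventually.of_forall fun ω => ?_)
    exact (integral_log_kernel (hU₁ ω) (hXr ω)).symm
  · have hG : Measurable fun p : (ℝ × ℝ) × ℝ =>
        Real.exp (-((p.1.2 + 1) * p.2)) * ((1 - Real.exp (-(p.1.1 * r * p.2))) / p.2) := by fun_prop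
    exact (hG.comp_aemeasurable (hXU.comp_fst.prodMk measurable_snd.aemeasurable)).aestronglyMeasurable
  · refine Filter.Eventually.of_forall fun ω => ?_
    filter_upwards [ae_restrict_mem measurableSet_Ioi] with s hs
    exact hpos ω s hs
  · filter_upwards [ae_restrict_mem measurableSet_Ioi] with s hs
    exact Filter.Eventually.of_forall fun ω => hpos ω s hs
  · exact Filter.Eventually.of_forall fun ω => integrableOn_log_kernel (hU₁ ω) (hXr ω)
  · filter_upwards [ae_restrict_mem measurableSet_Ioi] with s hs
    have hs' : (0 : ℝ) < s := hs
    refine Integrable.of_bound (C := 1 / s) (AEMeasurable.aestronglyMeasurable (by fun_prop))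
      (Filter.Eventually.of_forall fun ω => ?_)
    rw [Real.norm_of_nonneg (hpos ω s hs), ← one_mul (1 / s)]
    refine mul_le_mul ?_ ?_ ?_ zero_le_one
    · rw [Real.exp_le_one_iff]
      linarith [mul_pos (hU₁ ω) hs']
    · gcongr
      linarith [Real.exp_pos (-(X ω * r * s))]
    · refine div_nonneg ?_ hs'.le
      have : Real.exp (-(X ω * r * s)) ≤ 1 := by
        rw [Real.exp_le_one_iff]
        linarith [mul_nonneg (hXr ω) hs'.le]
      linarith

theorem integral_ratio {X U : Ω → ℝ} (hX : Integrable X μ) (hU : AEMeasurable U μ)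
    (hX₀ : ∀ ω, 0 ≤ X ω) (hU₀ : ∀ ω, 0 ≤ U ω) :
    ∫ ω, X ω / (U ω + 1) ∂μ = ∫ s in Set.Ioi (0 : ℝ),
      ∫ ω, X ω * Real.exp (-((U ω + 1) * s)) ∂μ := by
  have hU₁ : ∀ ω, 0 < U ω + 1 := fun ω => by linarith [hU₀ ω]
  have hpos : ∀ ω s, 0 ≤ X ω * Real.exp (-((U ω + 1) * s)) := fun ω s =>
    mul_nonneg (hX₀ ω) (Real.exp_pos _).le
  have hXU : AEMeasurable (fun ω => (X ω, U ω)) μ := hX.1.aemeasurable.prodMk hU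
  rw [← integral_integral_swap_of_nonneg]
  · refine integral_congr_ae (Filter.Eventually.of_forall fun ω => ?_)
    simp only
    rw [integral_const_mul, integral_exp_neg_mul (hU₁ ω), mul_one_div]
  · have hG : Measurable fun p : (ℝ × ℝ) × ℝ => p.1.1 * Real.exp (-((p.1.2 + 1) * p.2)) := by
      fun_prop
    exact (hG.comp_aemeasurable (hXU.comp_fst.prodMk measurable_snd.aemeasurable)).aestronglyMeasurable
  · exact Filter.Eventually.of_forall fun ω => Filter.Eventually.of_forall fun s => hpos ω s
  · exact Filter.Eventually.of_forall fun s => Filter.Eventually.of_forall fun ω => hpos ω s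
  · exact Filter.Eventually.of_forall fun ω => (integrableOn_exp_neg_mul (hU₁ ω)).const_mul _
  · filter_upwards [ae_restrict_mem measurableSet_Ioi] with s hs
    have hs' : (0 : ℝ) < s := hs
    refine hX.mul_bdd (c := 1) (AEMeasurable.aestronglyMeasurable (by fun_prop))
      (Filter.Eventually.of_forall fun ω => ?_)
    rw [Real.norm_of_nonneg (Real.exp_pos _).le, Real.exp_le_one_iff]
    linarith [mul_pos (hU₁ ω) hs']

/-- Jensen through the tangent line of the logarithm at the mean `m`: `log y ≤ log m + y/m - 1`, and
the linear part integrates to zero. -/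
theorem integral_log_le_log_integral {Y : Ω → ℝ} (hY : Integrable Y μ) (hY₁ : ∀ ω, 1 ≤ Y ω)
    (hlog : Integrable (fun ω => Real.log (Y ω)) μ) :
    ∫ ω, Real.log (Y ω) ∂μ ≤ Real.log (∫ ω, Y ω ∂μ) := by
  set m := ∫ ω, Y ω ∂μ with hm
  have hm₁ : 1 ≤ m := by
    have := integral_mono (integrable_const (1 : ℝ)) hY hY₁
    simpa using this
  have hm₀ : 0 < m := by linarith
  have h : ∀ ω, Real.log (Y ω) ≤ Real.log m + (Y ω / m - 1) := by
    intro ω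
    have hY₀ : 0 < Y ω := by linarith [hY₁ ω]
    have := Real.log_le_sub_one_of_pos (div_pos hY₀ hm₀)
    rw [Real.log_div hY₀.ne' hm₀.ne'] at this
    linarith
  have h1 : Integrable (fun ω => Y ω / m - 1) μ := (hY.div_const m).sub (integrable_const 1)
  refine (integral_mono hlog ((integrable_const _).add h1) h).trans_eq ?_
  simp only [Pi.add_apply]
  rw [integral_add (integrable_const _) h1, integral_sub (hY.div_const m) (integrable_const 1),
    integral_div, ← hm, div_self hm₀.ne']
  simp

end Expectations

section Channel

variable {Ω : Type*} [MeasurableSpace Ω] {μ : Measure Ω} {N M : ℕ}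
  {h₁ h₂ : Ω → Fin N → ℂ} {hI : Fin M → Ω → Fin N → ℂ}

theorem IsRayleighChannel.aemeasurable_relay_destination (h : IsRayleighChannel μ h₁ h₂ hI) :
    AEMeasurable h₂ μ :=
  aemeasurable_pi_lambda _ fun n => (h.law₂ n).aemeasurable

theorem IsRayleighChannel.aemeasurable_source_interferers (h : IsRayleighChannel μ h₁ h₂ hI) :
    AEMeasurable (fun ω => (h₁ ω, fun i => hI i ω)) μ :=
  (aemeasurable_pi_lambda _ fun n => (h.law₁ n).aemeasurable).prodMk
    (aemeasurable_pi_lambda _ fun i => aemeasurable_pi_lambda _ fun n => (h.lawI i n).aemeasurable)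

theorem IsRayleighChannel.aemeasurable_interference (h : IsRayleighChannel μ h₁ h₂ hI)
    (ρ : Fin M → ℝ) : AEMeasurable (fun ω => interference ρ (h₁ ω) fun i => hI i ω) μ :=
  Measurable.comp_aemeasurable
    (g := fun p : (Fin N → ℂ) × (Fin M → Fin N → ℂ) => interference ρ p.1 p.2)
    (f := fun ω => (h₁ ω, fun i => hI i ω)) (measurable_interference ρ)
    h.aemeasurable_source_interferers

variable [IsProbabilityMeasure μ]

theorem IsRayleighChannel.integral_mul_exp_neg (h : IsRayleighChannel μ h₁ h₂ hI)
    {ρ : Fin M → ℝ} (hρ : ∀ i, 0 < ρ i) {φ : (Fin N → ℂ) → ℝ} (hφm : Measurable φ)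
    (hφ : Integrable φ (Measure.pi fun _ => complexGaussian))
    (hφ₀ : ∀ v, sqNorm v = 0 → φ v = 0) {t : ℝ} (ht : 0 ≤ t) :
    ∫ ω, φ (h₁ ω) * Real.exp (-(t * interference ρ (h₁ ω) fun i => hI i ω)) ∂μ =
      (∫ v, φ v ∂(Measure.pi fun _ => complexGaussian)) * detLaplace ρ t := by
  have hm := measurable_interference (N := N) ρ
  rw [← integral_mul_exp_neg_interference hρ hφ hφ₀ ht, ← h.map_source_interferers,
    integral_map h.aemeasurable_source_interferers]
  refine Measurable.aestronglyMeasurable ?_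
  fun_prop

theorem IsRayleighChannel.integrable_sqNorm_relay_destination
    (h : IsRayleighChannel μ h₁ h₂ hI) : Integrable (fun ω => sqNorm (h₂ ω)) μ := by
  have := integrable_sqNorm (N := N)
  rw [← h.map_relay_destination] at this
  exact this.comp_aemeasurable h.aemeasurable_relay_destination

theorem IsRayleighChannel.integrable_sqNorm_source
    (h : IsRayleighChannel μ h₁ h₂ hI) : Integrable (fun ω => sqNorm (h₁ ω)) μ := by
  have := (integrable_sqNorm (N := N)).comp_fst (interfererLaw N M)
  rw [← h.map_source_interferers] at this
  exact this.comp_aemeasurable h.aemeasurable_source_interferers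

theorem integrable_exp_neg_sqNorm {r : ℝ} (hr : 0 ≤ r) :
    Integrable (fun v : Fin N → ℂ => Real.exp (-(r * sqNorm v)))
      (Measure.pi fun _ => complexGaussian) := by
  have := measurable_sqNorm (N := N)
  refine Integrable.of_bound (C := 1) (Measurable.aestronglyMeasurable (by fun_prop))
    (Filter.Eventually.of_forall fun v => ?_)
  rw [Real.norm_of_nonneg (Real.exp_pos _).le, Real.exp_le_one_iff]
  linarith [mul_nonneg hr (sqNorm_nonneg v)]

theorem integral_one_sub_exp_neg_sqNorm {r : ℝ} (hr : 0 ≤ r) :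
    ∫ v : Fin N → ℂ, (1 - Real.exp (-(r * sqNorm v))) ∂(Measure.pi fun _ => complexGaussian) =
      1 - 1 / (1 + r) ^ N := by
  rw [integral_sub (integrable_const _) (integrable_exp_neg_sqNorm hr),
    integral_exp_neg_sqNorm hr]
  simp

theorem IsRayleighChannel.integral_log_gamma1 (h : IsRayleighChannel μ h₁ h₂ hI)
    {ρ : Fin M → ℝ} (hρ : ∀ i, 0 < ρ i) {r : ℝ} (hr : 0 < r) :
    ∫ ω, Real.log (1 + gamma1 r ρ (h₁ ω) fun i => hI i ω) ∂μ = ∫ y in Set.Ioi (0 : ℝ),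
      Real.exp (-y) * ((1 - 1 / (1 + r * y) ^ N) / y) * detLaplace ρ y := by
  simp only [gamma1]
  rw [integral_log_one_add_ratio h.integrable_sqNorm_source.1.aemeasurable
    (h.aemeasurable_interference ρ) (fun ω => sqNorm_nonneg _)
    (fun ω => interference_nonneg hρ _ _) hr]
  refine setIntegral_congr_fun measurableSet_Ioi fun s hs => ?_
  have hs' : (0 : ℝ) < s := hs
  have hrs : 0 ≤ r * s := by positivity
  have e : ∀ ω, Real.exp (-((interference ρ (h₁ ω) (fun i => hI i ω) + 1) * s)) *
      ((1 - Real.exp (-(sqNorm (h₁ ω) * r * s))) / s) = Real.exp (-s) / s *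
      ((1 - Real.exp (-(r * s * sqNorm (h₁ ω)))) *
        Real.exp (-(s * interference ρ (h₁ ω) fun i => hI i ω))) := by
    intro ω
    rw [show -((interference ρ (h₁ ω) (fun i => hI i ω) + 1) * s) =
      -s + -(s * interference ρ (h₁ ω) fun i => hI i ω) by ring, Real.exp_add,
      show sqNorm (h₁ ω) * r * s = r * s * sqNorm (h₁ ω) by ring]
    ring
  have hm := measurable_sqNorm (N := N)
  simp_rw [e]
  -- The weight `1 - e^{-rs‖v‖²}` vanishes at `v = 0`, as the decoupling lemma demands.
  rw [integral_const_mul, h.integral_mul_exp_neg hρ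
    (φ := fun v => 1 - Real.exp (-(r * s * sqNorm v))) (by fun_prop)
    ((integrable_const _).sub (integrable_exp_neg_sqNorm hrs))
    (fun v hv => by simp [hv]) hs'.le, integral_one_sub_exp_neg_sqNorm hrs]
  ring

theorem IsRayleighChannel.integral_gamma1 (h : IsRayleighChannel μ h₁ h₂ hI)
    {ρ : Fin M → ℝ} (hρ : ∀ i, 0 < ρ i) {r : ℝ} (hr : 0 < r) :
    ∫ ω, gamma1 r ρ (h₁ ω) (fun i => hI i ω) ∂μ = r * (N * ∫ y in Set.Ioi (0 : ℝ),
      Real.exp (-y) * detLaplace ρ y) := by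
  have hm := measurable_sqNorm (N := N)
  simp only [gamma1]
  rw [integral_ratio (X := fun ω => sqNorm (h₁ ω) * r) (h.integrable_sqNorm_source.mul_const r)
    (h.aemeasurable_interference ρ) (fun ω => mul_nonneg (sqNorm_nonneg _) hr.le)
    (fun ω => interference_nonneg hρ _ _), ← mul_assoc, ← integral_const_mul]
  refine setIntegral_congr_fun measurableSet_Ioi fun s hs => ?_
  have hs' : (0 : ℝ) < s := hs
  have e : ∀ ω, sqNorm (h₁ ω) * r *
      Real.exp (-((interference ρ (h₁ ω) (fun i => hI i ω) + 1) * s)) = r * Real.exp (-s) *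
      (sqNorm (h₁ ω) * Real.exp (-(s * interference ρ (h₁ ω) fun i => hI i ω))) := by
    intro ω
    rw [show -((interference ρ (h₁ ω) (fun i => hI i ω) + 1) * s) =
      -s + -(s * interference ρ (h₁ ω) fun i => hI i ω) by ring, Real.exp_add]
    ring
  simp_rw [e]
  rw [integral_const_mul, h.integral_mul_exp_neg hρ hm integrable_sqNorm (fun v hv => hv) hs'.le,
    integral_sqNorm]
  ring

theorem IsRayleighChannel.integral_log_gamma2 (h : IsRayleighChannel μ h₁ h₂ hI)
    {r : ℝ} (hr : 0 < r) :
    ∫ ω, Real.log (1 + gamma2 r (h₂ ω)) ∂μ = ∫ y in Set.Ioi (0 : ℝ),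
      Real.exp (-y) * ((1 - 1 / (1 + r * y) ^ N) / y) := by
  have hm := measurable_sqNorm (N := N)
  have h0 := integral_log_one_add_ratio (U := fun _ => 0)
    h.integrable_sqNorm_relay_destination.1.aemeasurable
    aemeasurable_const (fun ω => sqNorm_nonneg _) (fun ω => le_rfl) hr
  simp only [zero_add, div_one, one_mul] at h0
  simp only [gamma2]
  rw [h0]
  refine setIntegral_congr_fun measurableSet_Ioi fun s hs => ?_
  have hs' : (0 : ℝ) < s := hs
  have hrs : 0 ≤ r * s := by positivity
  rw [integral_const_mul, integral_div, ← integral_one_sub_exp_neg_sqNorm hrs,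
    ← h.map_relay_destination, integral_map h.aemeasurable_relay_destination
      (Measurable.aestronglyMeasurable (by fun_prop))]
  congr 3
  ext ω
  ring_nf

theorem IsRayleighChannel.integral_gamma2 (h : IsRayleighChannel μ h₁ h₂ hI) (r : ℝ) :
    ∫ ω, gamma2 r (h₂ ω) ∂μ = N * r := by
  simp only [gamma2]
  rw [integral_mul_const, ← integral_sqNorm (N := N), ← h.map_relay_destination,
    integral_map h.aemeasurable_relay_destination measurable_sqNorm.aestronglyMeasurable]

end Channel

/-! ### The end-to-end SINR -/

theorem cdot_self {N : ℕ} (v : Fin N → ℂ) : cdot v v = (sqNorm v : ℂ) := by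
  simp only [cdot, dotProduct, sqNorm, Complex.ofReal_sum]
  refine Finset.sum_congr rfl fun n _ => ?_
  rw [Pi.star_apply, Complex.ofReal_pow]
  exact Complex.conj_mul' (v n)

theorem sq_frobNorm {N : ℕ} (v : Fin N → ℂ) : frobNorm v ^ 2 = sqNorm v :=
  Real.sq_sqrt (sqNorm_nonneg v)

theorem cdot_div_frobNorm {N : ℕ} (v w : Fin N → ℂ) (c : ℂ) :
    cdot v (fun n => w n / c) = cdot v w / c := by
  simp only [cdot, dotProduct, Finset.sum_div, mul_div_assoc]

theorem norm_cdot_self_div_frobNorm {N : ℕ} (v : Fin N → ℂ) :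
    ‖cdot v (fun n => v n / (frobNorm v : ℂ))‖ ^ 2 = sqNorm v := by
  rw [cdot_div_frobNorm, cdot_self, norm_div, Complex.norm_real, Complex.norm_real, div_pow,
    Real.norm_eq_abs, Real.norm_eq_abs, sq_abs, sq_abs, sq_frobNorm, sq, mul_self_div_self]

theorem star_div_frobNorm_dotProduct {N : ℕ} (v w : Fin N → ℂ) :
    ‖dotProduct (fun n => star (v n) / (frobNorm v : ℂ)) w‖ ^ 2 = ‖cdot v w‖ ^ 2 / sqNorm v := by
  have : dotProduct (fun n => star (v n) / (frobNorm v : ℂ)) w = cdot v w / (frobNorm v : ℂ) := by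
    simp only [cdot, dotProduct, Finset.sum_div, Pi.star_apply, div_mul_eq_mul_div]
  rw [this, norm_div, Complex.norm_real, div_pow, Real.norm_eq_abs, sq_abs, sq_frobNorm]

theorem sqNorm_smul {N : ℕ} (c : ℂ) (v : Fin N → ℂ) : sqNorm (c • v) = ‖c‖ ^ 2 * sqNorm v := by
  simp only [sqNorm, Pi.smul_apply, smul_eq_mul, norm_mul, mul_pow, Finset.mul_sum]

theorem sqNorm_star_div_frobNorm {N : ℕ} (v : Fin N → ℂ) :
    sqNorm (fun n => star (v n) / (frobNorm v : ℂ)) = sqNorm v / sqNorm v := by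
  have : sqNorm (fun n => star (v n) / (frobNorm v : ℂ)) = sqNorm v / frobNorm v ^ 2 := by
    simp only [sqNorm, norm_div, norm_star, Complex.norm_real, div_pow, Real.norm_eq_abs, sq_abs,
      Finset.sum_div]
  rw [this, sq_frobNorm]

theorem norm_cdot_mrcMatrix_mulVec {N M : ℕ} (ρ₁ ρ₂ : ℝ) (ρI : Fin M → ℝ) (h₁ h₂ : Fin N → ℂ)
    (hI : Fin M → Fin N → ℂ) (w : Fin N → ℂ) :
    ‖cdot h₂ ((mrcMatrix ρ₁ ρ₂ ρI h₁ h₂ hI).mulVec w)‖ ^ 2 =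
      mrcOmega ρ₁ ρ₂ ρI h₁ hI ^ 2 * sqNorm h₂ * (‖cdot h₁ w‖ ^ 2 / sqNorm h₁) := by
  rw [← star_div_frobNorm_dotProduct, ← norm_cdot_self_div_frobNorm h₂, mrcMatrix,
    Matrix.smul_mulVec, Matrix.vecMulVec_mulVec]
  simp only [cdot, dotProduct_smul, Complex.norm_real, mul_pow, Real.norm_eq_abs, sq_abs,
    MulOpposite.smul_eq_mul_unop, MulOpposite.unop_op, norm_mul, smul_eq_mul]
  ring

/-- The quotient `sqNorm h₁ / sqNorm h₁` is kept because it is `0`, not `1`, when `h₁ = 0`. -/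
theorem sqNorm_vecMul_mrcMatrix {N M : ℕ} (ρ₁ ρ₂ : ℝ) (ρI : Fin M → ℝ) (h₁ h₂ : Fin N → ℂ)
    (hI : Fin M → Fin N → ℂ) :
    sqNorm (Matrix.vecMul (star h₂) (mrcMatrix ρ₁ ρ₂ ρI h₁ h₂ hI)) =
      mrcOmega ρ₁ ρ₂ ρI h₁ hI ^ 2 * sqNorm h₂ * (sqNorm h₁ / sqNorm h₁) := by
  rw [← sqNorm_star_div_frobNorm, ← norm_cdot_self_div_frobNorm h₂, mrcMatrix,
    Matrix.vecMul_smul, Matrix.vecMul_vecMulVec, sqNorm_smul, sqNorm_smul, Complex.norm_real,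
    Real.norm_eq_abs, sq_abs]
  simp only [cdot]
  ring

/-- With `W` of rank one every term of the SINR is `ω²‖h₂‖²` times a first-hop quantity; inserting
the power constraint for `ω²` and dividing by `N₀` leaves the harmonic-type combination of the two
hops. -/
theorem gammaMRC_eq {N M : ℕ} {P Pr N₀ : ℝ} {PI : Fin M → ℝ} (hP : 0 < P) (hPr : 0 < Pr)
    (hN₀ : 0 < N₀) (hPI : ∀ i, 0 < PI i) (h₁ h₂ : Fin N → ℂ) (hI : Fin M → Fin N → ℂ) :
    gammaMRC P Pr N₀ PI h₁ h₂ hI =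
      gamma1 (P / N₀) (fun i => PI i / N₀) h₁ hI * gamma2 (Pr / N₀) h₂ /
        (gamma1 (P / N₀) (fun i => PI i / N₀) h₁ hI + gamma2 (Pr / N₀) h₂ + 1) := by
  have hU : 0 ≤ interference (fun i => PI i / N₀) h₁ hI :=
    interference_nonneg (fun i => div_pos (hPI i) hN₀) _ _
  have hX₁ := sqNorm_nonneg h₁
  have hX₂ := sqNorm_nonneg h₂
  have hω : mrcOmega (P / N₀) (Pr / N₀) (fun i => PI i / N₀) h₁ hI ^ 2 = Pr / N₀ /
      (sqNorm h₁ * (P / N₀) + interference (fun i => PI i / N₀) h₁ hI + 1) :=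
    Real.sq_sqrt (by positivity)
  have hsum : ∀ c : ℝ, ∑ i, c * (‖cdot h₁ (hI i)‖ ^ 2 / sqNorm h₁) * PI i =
      c * interference (fun i => PI i / N₀) h₁ hI * N₀ := by
    intro c
    rw [interference, Finset.mul_sum, Finset.sum_mul]
    refine Finset.sum_congr rfl fun i _ => ?_
    field_simp
  rw [gammaMRC, endToEndSINR]
  simp only [norm_cdot_mrcMatrix_mulVec, sqNorm_vecMul_mrcMatrix, hsum, cdot_self,
    Complex.norm_real, Real.norm_eq_abs, sq_abs, gamma1, gamma2, hω]
  generalize interference (fun i => PI i / N₀) h₁ hI = U at hU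
  generalize sqNorm h₁ = X₁ at hX₁
  generalize sqNorm h₂ = X₂ at hX₂
  -- For `h₁ = 0` both numerators vanish; `h₂ = 0` needs no separate case, as `‖h₂‖²` is never
  -- cancelled from a denominator.
  rcases hX₁.eq_or_lt with rfl | hX₁
  · simp
  · rw [div_self hX₁.ne']
    field_simp
    ring

theorem one_add_mul_div {x y : ℝ} (hx : 0 ≤ x) (hy : 0 ≤ y) :
    1 + x * y / (x + y + 1) = (1 + x) * (1 + y) / (1 + (x + y)) := by
  have : x + y + 1 ≠ 0 := by positivity
  have : 1 + (x + y) ≠ 0 := by positivity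
  field_simp
  ring

theorem integrable_log_one_add {Ω : Type*} [MeasurableSpace Ω] {μ : Measure Ω} {X : Ω → ℝ}
    (hX : Integrable X μ) (h₀ : ∀ ω, 0 ≤ X ω) : Integrable (fun ω => Real.log (1 + X ω)) μ := by
  refine hX.mono' (Real.measurable_log.comp_aemeasurable
    (hX.1.aemeasurable.const_add 1)).aestronglyMeasurable
    (Filter.Eventually.of_forall fun ω => ?_)
  have h1 : 0 < 1 + X ω := by linarith [h₀ ω]
  rw [Real.norm_of_nonneg (Real.log_nonneg (by linarith [h₀ ω]))]
  linarith [Real.log_le_sub_one_of_pos h1]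

end RelayMRC

end

/-! ### The capacity bound -/

theorem theorem2 {Ω : Type*} [MeasurableSpace Ω] (μ : Measure Ω) [IsProbabilityMeasure μ]
    (N M : ℕ) (hN : 0 < N) (hM : 0 < M)
    (P Pr N₀ : ℝ) (PI : Fin M → ℝ)
    (hP : 0 < P) (hPr : 0 < Pr) (hN₀ : 0 < N₀) (hPI : ∀ i, 0 < PI i)
    (ρ₁ ρ₂ : ℝ) (ρI : Fin M → ℝ)
    (hρ₁ : ρ₁ = P / N₀) (hρ₂ : ρ₂ = Pr / N₀) (hρI : ∀ i, ρI i = PI i / N₀)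
    (h₁ h₂ : Ω → Fin N → ℂ) (hI : Fin M → Ω → Fin N → ℂ)
    (hch : RelayMRC.IsRayleighChannel μ h₁ h₂ hI)
    (γMRC γ₁ γ₂ : Ω → ℝ)
    (hγMRC : ∀ ω, γMRC ω = RelayMRC.gammaMRC P Pr N₀ PI (h₁ ω) (h₂ ω) (fun i => hI i ω))
    (hγ₁ : ∀ ω, γ₁ ω = RelayMRC.gamma1 ρ₁ ρI (h₁ ω) (fun i => hI i ω))
    (hγ₂ : ∀ ω, γ₂ ω = RelayMRC.gamma2 ρ₂ (h₂ ω)) :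
    -- all the expectations below exist
    (Integrable (fun ω => Real.logb 2 (1 + γMRC ω)) μ
      ∧ Integrable (fun ω => Real.logb 2 (1 + γ₁ ω)) μ
      ∧ Integrable (fun ω => Real.logb 2 (1 + γ₂ ω)) μ
      ∧ Integrable γ₁ μ ∧ Integrable γ₂ μ)
    -- the closed-form lower bound
    ∧ RelayMRC.capacityLow N ρ₁ ρ₂ ρI ≤ RelayMRC.ergodicCapacity μ γMRC
    -- the meaning of its terms
    ∧ RelayMRC.ergodicCapacity μ γ₁ = RelayMRC.capacityTerm1 N ρ₁ ρI
    ∧ RelayMRC.ergodicCapacity μ γ₂ = RelayMRC.capacityTerm2 N ρ₂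
    ∧ ∫ ω, γ₁ ω ∂μ = RelayMRC.meanTerm1 N ρ₁ ρI
    ∧ ∫ ω, γ₂ ω ∂μ = N * ρ₂ := by
  have hr₁ : 0 < ρ₁ := hρ₁ ▸ div_pos hP hN₀
  have hr₂ : 0 < ρ₂ := hρ₂ ▸ div_pos hPr hN₀
  have hrI : ∀ i, 0 < ρI i := fun i => hρI i ▸ div_pos (hPI i) hN₀
  have hU : ∀ ω, 0 ≤ RelayMRC.interference ρI (h₁ ω) fun i => hI i ω := fun ω =>
    RelayMRC.interference_nonneg hrI _ _
  have hX₁ : ∀ ω, 0 ≤ RelayMRC.sqNorm (h₁ ω) * ρ₁ := fun ω =>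
    mul_nonneg (RelayMRC.sqNorm_nonneg _) hr₁.le
  have hγ₁₀ : ∀ ω, 0 ≤ γ₁ ω := fun ω => by
    rw [hγ₁]
    exact div_nonneg (hX₁ ω) (by linarith [hU ω])
  have hγ₂₀ : ∀ ω, 0 ≤ γ₂ ω := fun ω => by
    rw [hγ₂]
    exact mul_nonneg (RelayMRC.sqNorm_nonneg _) hr₂.le
  have hγ₁i : Integrable γ₁ μ := by
    have hX := hch.integrable_sqNorm_source.mul_const ρ₁
    refine hX.mono' ?_ (Filter.Eventually.of_forall fun ω => ?_)
    · rw [funext hγ₁]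
      exact (hX.1.aemeasurable.div
        ((hch.aemeasurable_interference ρI).add_const 1)).aestronglyMeasurable
    · rw [Real.norm_of_nonneg (hγ₁₀ ω), hγ₁]
      -- Interference only lowers the SINR: `U₁ + 1 ≥ 1`, so `γ₁` is dominated by the integrable
      -- `‖h₁‖²ρ₁`.
      exact div_le_self (hX₁ ω) (by linarith [hU ω])
  have hγ₂i : Integrable γ₂ μ := by
    rw [funext hγ₂]
    exact hch.integrable_sqNorm_relay_destination.mul_const ρ₂
  have hγ : ∀ ω, γMRC ω = γ₁ ω * γ₂ ω / (γ₁ ω + γ₂ ω + 1) := fun ω => by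
    rw [hγMRC, RelayMRC.gammaMRC_eq hP hPr hN₀ hPI, hγ₁, hγ₂, hρ₁, hρ₂, funext hρI]
  have hl₁ := RelayMRC.integrable_log_one_add hγ₁i hγ₁₀
  have hl₂ := RelayMRC.integrable_log_one_add hγ₂i hγ₂₀
  have hl₃ := RelayMRC.integrable_log_one_add (hγ₁i.add hγ₂i) fun ω =>
    add_nonneg (hγ₁₀ ω) (hγ₂₀ ω)
  simp only [Pi.add_apply] at hl₃
  have hlog : ∀ ω, Real.log (1 + γMRC ω) =
      Real.log (1 + γ₁ ω) + Real.log (1 + γ₂ ω) - Real.log (1 + (γ₁ ω + γ₂ ω)) := fun ω => by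
    have h1 := hγ₁₀ ω
    have h2 := hγ₂₀ ω
    rw [hγ, RelayMRC.one_add_mul_div h1 h2, Real.log_div (by positivity) (by positivity),
      Real.log_mul (by positivity) (by positivity)]
  have hl : Integrable (fun ω => Real.log (1 + γMRC ω)) μ := by
    simp_rw [hlog]
    exact (hl₁.add hl₂).sub hl₃
  have hC₁ : RelayMRC.ergodicCapacity μ γ₁ = RelayMRC.capacityTerm1 N ρ₁ ρI := by
    rw [RelayMRC.ergodicCapacity, RelayMRC.capacityTerm1_eq N hM hr₁ ρI hrI,
      ← hch.integral_log_gamma1 hrI hr₁]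
    simp only [Real.logb, integral_div, hγ₁]
    ring
  have hC₂ : RelayMRC.ergodicCapacity μ γ₂ = RelayMRC.capacityTerm2 N ρ₂ := by
    rw [RelayMRC.ergodicCapacity, RelayMRC.capacityTerm2_eq N hr₂, ← hch.integral_log_gamma2 hr₂]
    simp only [Real.logb, integral_div, hγ₂]
    ring
  have hE₁ : ∫ ω, γ₁ ω ∂μ = RelayMRC.meanTerm1 N ρ₁ ρI := by
    rw [RelayMRC.meanTerm1_eq N hM ρ₁ ρI hrI, ← hch.integral_gamma1 hrI hr₁]
    simp only [hγ₁]
  have hE₂ : ∫ ω, γ₂ ω ∂μ = N * ρ₂ := by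
    simp only [hγ₂]
    exact hch.integral_gamma2 ρ₂
  refine ⟨⟨hl.div_const _, hl₁.div_const _, hl₂.div_const _, hγ₁i, hγ₂i⟩, ?_, hC₁, hC₂, hE₁, hE₂⟩
  -- Jensen is applied to `1 + γ₁ + γ₂`, whose logarithm enters with a minus sign; an upper bound
  -- here becomes the lower bound on the capacity.
  have hJ := RelayMRC.integral_log_le_log_integral ((integrable_const 1).add (hγ₁i.add hγ₂i))
    (fun ω => by
      have h1 := hγ₁₀ ω
      have h2 := hγ₂₀ ω
      simp only [Pi.add_apply]
      linarith) hl₃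
  simp only [Pi.add_apply] at hJ
  have hmean : ∫ ω, (1 + (γ₁ ω + γ₂ ω)) ∂μ = 1 + N * ρ₂ + RelayMRC.meanTerm1 N ρ₁ ρI := by
    have h := integral_add (integrable_const (1 : ℝ)) (hγ₁i.add hγ₂i)
    simp only [Pi.add_apply] at h
    rw [h, integral_add hγ₁i hγ₂i, hE₁, hE₂, integral_const, probReal_univ, one_smul]
    ring
  have hsplit : ∫ ω, Real.log (1 + γMRC ω) ∂μ = ∫ ω, Real.log (1 + γ₁ ω) ∂μ +
      ∫ ω, Real.log (1 + γ₂ ω) ∂μ - ∫ ω, Real.log (1 + (γ₁ ω + γ₂ ω)) ∂μ := by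
    have h := integral_sub (hl₁.add hl₂) hl₃
    simp only [Pi.add_apply] at h
    simp_rw [hlog]
    rw [h, integral_add hl₁ hl₂]
  rw [hmean] at hJ
  have hln : 0 < Real.log 2 := Real.log_pos one_lt_two
  rw [RelayMRC.capacityLow, ← hC₁, ← hC₂]
  simp only [RelayMRC.ergodicCapacity, Real.logb, integral_div, hsplit]
  rw [← mul_add, ← add_div, ← mul_sub, ← sub_div]
  gcongr
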